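/- Let $\mathbb Z$ be a real Hilbert space, let $\mathcal A$ generate a $C_0$-semigroup on $\mathbb Z$, let $\mathcal B:\mathbb R^{n_u}\to\mathbb Z$ and $\mathcal C:\mathbb Z\to\mathbb R^{n_y}$ be bounded linear operators (so that $\mathcal B^*$ is bounded), and let $R$ be a symmetric positive definite $n_u\times n_u$ matrix. Assume that $(\mathcal A,\mathcal B)$ is exponentially stabilizable and $(\mathcal A,\mathcal C)$ is exponentially detectable, and let $\Pi$ be the bounded, self-adjoint, nonnegative solution of the algebraic Riccati equation $$\langle z_2,\Pi\mathcal A z_1\rangle+\langle\mathcal A z_2,\Pi z_1\rangle+\langle\mathcal C z_1,\mathcal C z_2\rangle-\langle\Pi\mathcal B R^{-1}\mathcal B^*\Pi z_1,z_2\rangle=0,\qquad z_1,z_2\in\mathcal D(\mathcal A).$$ Then $\mathcal A_m=\mathcal A-\mathcal B\mathcal K$, where $\mathcal K=R^{-1}\mathcal B^*\Pi$, generates a $C_0$-semigroup $e^{\mathcal A_m t}$, and the observability Gramian $W_o z=\int_0^\infty e^{\mathcal A_m^*\tau}\mathcal C^*\mathcal C e^{\mathcal A_m\tau}z\,d\tau$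 converges for every $z\in\mathbb Z$. Consider, with $f\equiv0$ and $r\equiv0$ and in the sense of mild solutions, the system $$\dot v_p=\mathcal A_m v_p,\qquad \dot v_h=\mathcal A v_h+\mathcal B u,\qquad v=v_p+v_h,$$ with arbitrary initial states in $\mathbb Z$ and the control law $$u_{\rm reg}=-R^{-1}\mathcal B^*\Pi v_h-R^{-1}\mathcal B^* q,\qquad q=W_o v_p,$$ where the static feedforward $W_o v_p(t)$ is the limit, as $T\to\infty$, of $q_T(t)=\int_T^t e^{-\mathcal A_m^*(t-s)}\mathcal C^*\sigma(s)\,ds$ with $\sigma=-\mathcal C v_p$. Let $u_{\rm lqr}(z)=-R^{-1}\mathcal B^*\Pi z$ be the classic LQR law, and let $v^\star$ be a trajectory of $\dot v^\star=\mathcal A v^\star+\mathcal B u_{\rm lqr}(v^\star)$. There are constants $M,\beta>0$, independent of the initial states, such that for all $t\ge0$: (a) as a law for the state $v(t)=z$, that is, with $v_h=z-v_p(t)$, the control law $u_{\rm reg}$ at time $t$ differs from $u_{\rm lqr}(z)$ in norm by at most $Me^{-\beta t}\|v_p(0)\|$, for every $z\in\mathbb Z$; so it converges exponentially fast to the LQR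 law; (b) the error of the control signals is bounded: $\|u_{\rm reg}(t)-u_{\rm lqr}(v^\star(t))\|\le M\big(\|v_p(0)\|+\|v(0)-v^\star(0)\|\big)$. The same bound holds if $v$ is instead the state of the plant $\dot v=\mathcal A v+\mathcal B u_{\rm reg}$ with $v_h=v-v_p$ in the control law. -/

import Mathlib

open Set Filter Topology MeasureTheory

noncomputable section

namespace DyadicControl

variable {Z U Y : Type*} [NormedAddCommGroup Z] [InnerProductSpace ℝ Z] [CompleteSpace Z]
  [NormedAddCommGroup U] [InnerProductSpace ℝ U] [CompleteSpace U]
  [NormedAddCommGroup Y] [InnerProductSpace ℝ Y] [CompleteSpace Y]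

/-- A strongly continuous (`C₀`) semigroup of bounded operators on `Z`; only the values at times
`t ≥ 0` matter. -/
structure IsC0Semigroup (T : ℝ → Z →L[ℝ] Z) : Prop where
  zero : T 0 = ContinuousLinearMap.id ℝ Z
  add : ∀ s t : ℝ, 0 ≤ s → 0 ≤ t → T (s + t) = (T s).comp (T t)
  continuousOn : ∀ z : Z, ContinuousOn (fun t => T t z) (Ici 0)

/-- The (unbounded) operator `A` is the infinitesimal generator of the `C₀` semigroup `T`:
`z` lies in the domain of `A` and `A z = y` if and only if `(T h z - z) / h → y` as `h ↓ 0`. -/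
def Generates (A : Z →ₗ.[ℝ] Z) (T : ℝ → Z →L[ℝ] Z) : Prop :=
  IsC0Semigroup T ∧
    ∀ z y : Z, (z, y) ∈ A.graph ↔
      Tendsto (fun h : ℝ => h⁻¹ • (T h z - z)) (𝓝[>] 0) (𝓝 y)

/-- Exponential stability: `‖T t‖ ≤ M e^{-β t}` for all `t ≥ 0`, with some `M, β > 0`. -/
def IsExpStable (T : ℝ → Z →L[ℝ] Z) : Prop :=
  ∃ M β : ℝ, 0 < M ∧ 0 < β ∧ ∀ t : ℝ, 0 ≤ t → ‖T t‖ ≤ M * Real.exp (-β * t)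

/-- The operator `A + G`, with the domain of `A`, for a bounded operator `G` on `Z`. -/
def boundedPerturbation (A : Z →ₗ.[ℝ] Z) (G : Z →L[ℝ] Z) : Z →ₗ.[ℝ] Z :=
  (G : Z →ₗ[ℝ] Z) +ᵥ A

/-- `(A, B)` is exponentially stabilizable: `A + B F` generates an exponentially stable semigroup
for some bounded feedback `F`. -/
def IsExpStabilizable (A : Z →ₗ.[ℝ] Z) (B : U →L[ℝ] Z) : Prop :=
  ∃ (F : Z →L[ℝ] U) (T : ℝ → Z →L[ℝ] Z),
    Generates (boundedPerturbation A (B.comp F)) T ∧ IsExpStable T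

/-- `(A, C)` is exponentially detectable: `A + L C` generates an exponentially stable semigroup
for some bounded output injection `L`. -/
def IsExpDetectable (A : Z →ₗ.[ℝ] Z) (C : Z →L[ℝ] Y) : Prop :=
  ∃ (L : Y →L[ℝ] Z) (T : ℝ → Z →L[ℝ] Z),
    Generates (boundedPerturbation A (L.comp C)) T ∧ IsExpStable T

/-- Mild solution on `[0, ∞)` of `v' = A v + f (t, v)`, `v 0 = v₀`, where `A` generates `T`. -/
def IsMildSolution (T : ℝ → Z →L[ℝ] Z) (f : ℝ → Z → Z) (v₀ : Z) (v : ℝ → Z) : Prop :=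
  ContinuousOn v (Ici 0) ∧
    ∀ t : ℝ, 0 ≤ t → v t = T t v₀ + ∫ τ in (0 : ℝ)..t, T (t - τ) (f τ (v τ))

/-- The operator `R⁻¹` on `ℝⁿ` with its Euclidean norm (used for positive definite `R`). -/
def weightInv {n : ℕ} (R : Matrix (Fin n) (Fin n) ℝ) :
    EuclideanSpace ℝ (Fin n) →L[ℝ] EuclideanSpace ℝ (Fin n) :=
  Matrix.toEuclideanCLM (𝕜 := ℝ) R⁻¹

/-- The operator `R⁻¹ B*`. -/
def weightedAdjoint {n : ℕ} (B : EuclideanSpace ℝ (Fin n) →L[ℝ] Z)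
    (R : Matrix (Fin n) (Fin n) ℝ) : Z →L[ℝ] EuclideanSpace ℝ (Fin n) :=
  (weightInv R).comp (ContinuousLinearMap.adjoint B)

/-- The gain `K = R⁻¹ B* P` of the linear quadratic regulator. -/
def lqrGain {n : ℕ} (B : EuclideanSpace ℝ (Fin n) →L[ℝ] Z) (R : Matrix (Fin n) (Fin n) ℝ)
    (P : Z →L[ℝ] Z) : Z →L[ℝ] EuclideanSpace ℝ (Fin n) :=
  (weightedAdjoint B R).comp P

/-- `P` is a bounded, self-adjoint, nonnegative solution of the algebraic Riccati equation
`A* P + P A + C* C - P B R⁻¹ B* P = 0`, in its weak form on the domain of `A`. -/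
structure IsRiccatiSolution {n : ℕ} (A : Z →ₗ.[ℝ] Z) (B : EuclideanSpace ℝ (Fin n) →L[ℝ] Z)
    (C : Z →L[ℝ] Y) (R : Matrix (Fin n) (Fin n) ℝ) (P : Z →L[ℝ] Z) : Prop where
  selfAdjoint : IsSelfAdjoint P
  nonneg : ∀ z : Z, 0 ≤ inner ℝ z (P z)
  riccati : ∀ z₁ z₂ : A.domain,
    inner ℝ (z₂ : Z) (P (A z₁)) + inner ℝ (A z₂) (P (z₁ : Z))
      + inner ℝ (C (z₁ : Z)) (C (z₂ : Z))
      - inner ℝ (P (B (lqrGain B R P (z₁ : Z)))) (z₂ : Z) = 0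

/-- The closed-loop operator `A_m = A - B R⁻¹ B* P`, with the domain of `A`. -/
def closedLoop {n : ℕ} (A : Z →ₗ.[ℝ] Z) (B : EuclideanSpace ℝ (Fin n) →L[ℝ] Z)
    (R : Matrix (Fin n) (Fin n) ℝ) (P : Z →L[ℝ] Z) : Z →ₗ.[ℝ] Z :=
  boundedPerturbation A (-(B.comp (lqrGain B R P)))

/-- The integrand `e^{A_m* τ} C* C e^{A_m τ} z` of the observability Gramian. -/
def gramianIntegrand (Tm : ℝ → Z →L[ℝ] Z) (C : Z →L[ℝ] Y) (z : Z) (τ : ℝ) : Z :=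
  ContinuousLinearMap.adjoint (Tm τ) (ContinuousLinearMap.adjoint C (C (Tm τ z)))

/-- The observability Gramian `W_o z = ∫_0^∞ e^{A_m* τ} C* C e^{A_m τ} z dτ`. -/
def obsGramian (Tm : ℝ → Z →L[ℝ] Z) (C : Z →L[ℝ] Y) (z : Z) : Z :=
  ∫ τ in Ioi (0 : ℝ), gramianIntegrand Tm C z τ

/-- The feedforward with horizon `T`: the mild solution
`q(t) = ∫_T^t e^{-A_m* (t - s)} C* σ(s) ds` of `q' = -A_m* q + C* σ`, `q(T) = 0`. -/
def horizonFeedforward (Tm : ℝ → Z →L[ℝ] Z) (C : Z →L[ℝ] Y) (σ : ℝ → Y) (T t : ℝ) : Z :=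
  ∫ s in T..t, ContinuousLinearMap.adjoint (Tm (s - t)) (ContinuousLinearMap.adjoint C (σ s))

/-- The classic linear quadratic regulator `u = -R⁻¹ B* P v`. -/
def lqrLaw {n : ℕ} (B : EuclideanSpace ℝ (Fin n) →L[ℝ] Z) (R : Matrix (Fin n) (Fin n) ℝ)
    (P : Z →L[ℝ] Z) (v : Z) : EuclideanSpace ℝ (Fin n) :=
  -lqrGain B R P v

/-- The dyadic law `u = -R⁻¹ B* P v_h - R⁻¹ B* q` with the static feedforward `q = W_o v_p`. -/
def regLaw {n : ℕ} (Tm : ℝ → Z →L[ℝ] Z) (B : EuclideanSpace ℝ (Fin n) →L[ℝ] Z)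
    (C : Z →L[ℝ] Y) (R : Matrix (Fin n) (Fin n) ℝ) (P : Z →L[ℝ] Z) (vp vh : Z) :
    EuclideanSpace ℝ (Fin n) :=
  -lqrGain B R P vh - weightedAdjoint B R (obsGramian Tm C vp)

end DyadicControl

end

/-!
A `C₀`-semigroup survives a bounded perturbation because the variation of constants formula is a
fixed point equation, contractive on `[0, ∞)` after an exponential rescaling.

Along orbits of the closed loop `A - B K` the Riccati equation says that `⟨z, P z⟩` decreases at
the rate `‖C z‖² + ⟨R K z, K z⟩`, so the integral of this running cost is at most `⟨z, P z⟩` at the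
initial state. Seen from the stable operator `A + L C`, the closed loop is driven by the forcing
`-(B K + L C) z`, which is square integrable since the cost is integrable; hence its orbits are
square integrable, and Datko's theorem makes it exponentially stable.

Consequently the Gramian is a bounded operator `W`, and the two laws differ by `(K - R⁻¹ B* W) v_p`,
an exponentially decaying signal. Entering the exponentially stable closed loop as a bounded
disturbance, it leaves the deviation between the two trajectories bounded.
-/

namespace DyadicControl

open scoped BoundedContinuousFunction InnerProduct InnerProductSpace NNReal

section Analysis

variable {E F X : Type*} [NormedAddCommGroup E] [NormedSpace ℝ E] [NormedAddCommGroup F]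
  [NormedSpace ℝ F] [TopologicalSpace X]

theorem continuousOn_clm_apply_of_dense {L : X → E →L[ℝ] F} {s : Set X} {D : Set E}
    (hbdd : ∀ x ∈ s, ∃ M, ∀ᶠ x' in 𝓝[s] x, ‖L x'‖ ≤ M) (hD : Dense D)
    (hL : ∀ y ∈ D, ContinuousOn (fun x => L x y) s) :
    ContinuousOn (fun p : X × E => L p.1 p.2) (s ×ˢ univ) := by
  rintro ⟨x, z⟩ ⟨hx, -⟩
  obtain ⟨M, hM⟩ := hbdd x hx
  set u := {x' ∈ s | ‖L x'‖ ≤ M}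
  have hu : u ∈ 𝓝[s] x := inter_mem self_mem_nhdsWithin hM
  have hcont : ContinuousOn (fun p : X × E => L p.1 p.2) (u ×ˢ univ) :=
    continuousOn_prod_of_subset_closure_continuousOn_lipschitzOnWith' _ (subset_univ D)
      hD.closure_eq.ge M.toNNReal
      (fun x' hx' => ((L x').lipschitz.weaken (NNReal.le_toNNReal_of_coe_le hx'.2)).lipschitzOnWith)
      fun y hy => (hL y hy).mono (sep_subset _ _)
  refine (hcont (x, z) ⟨mem_of_mem_nhdsWithin hx hu, trivial⟩).mono_of_mem_nhdsWithin ?_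
  rw [nhdsWithin_prod_eq]
  exact prod_mem_prod hu univ_mem

theorem continuousOn_intervalIntegral_of_continuousOn {f : X → ℝ → E} {s : Set X} {a b : ℝ}
    (hab : a ≤ b) (hf : ContinuousOn f.uncurry (s ×ˢ Icc a b)) :
    ContinuousOn (fun x => ∫ q in a..b, f x q) s := by
  rw [continuousOn_iff_continuous_domRestrict]
  have hf' : Continuous (fun (x : s) q => f x (projIcc a b hab q)).uncurry :=
    hf.comp_continuous (f := fun p : s × ℝ => ((p.1 : X), (projIcc a b hab p.2 : ℝ)))
      (by fun_prop) fun p => ⟨p.1.2, (projIcc a b hab p.2).2⟩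
  refine (intervalIntegral.continuous_parametric_intervalIntegral_of_continuous' hf' a b).congr
    fun x => intervalIntegral.integral_congr fun q hq => ?_
  rw [uIcc_of_le hab] at hq
  simp only [projIcc_of_mem hab hq]

theorem hasDerivWithinAt_Ioi_of_tendsto {f : ℝ → E} {y : E} {s : ℝ}
    (h : Tendsto (fun r : ℝ => r⁻¹ • (f (s + r) - f s)) (𝓝[>] 0) (𝓝 y)) :
    HasDerivWithinAt f y (Ioi s) s := by
  rw [hasDerivWithinAt_iff_tendsto_slope' self_notMem_Ioi]
  have hshift : Tendsto (fun x => x - s) (𝓝[>] s) (𝓝[>] 0) :=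
    tendsto_nhdsWithin_iff.2 ⟨((continuous_sub_right s).tendsto' s 0 (sub_self s)).mono_left
      nhdsWithin_le_nhds, eventually_mem_nhdsWithin.mono fun x hx => sub_pos.2 (mem_Ioi.1 hx)⟩
  refine (h.comp hshift).congr fun x => ?_
  rw [Function.comp_apply, add_sub_cancel, slope_def_module]

end Analysis

section Semigroup

variable {Z : Type*} [NormedAddCommGroup Z] [InnerProductSpace ℝ Z] {T : ℝ → Z →L[ℝ] Z}

theorem IsC0Semigroup.apply_add (hT : IsC0Semigroup T) {s t : ℝ} (hs : 0 ≤ s) (ht : 0 ≤ t)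
    (z : Z) : T (s + t) z = T s (T t z) := by
  rw [hT.add s t hs ht, ContinuousLinearMap.comp_apply]

theorem IsC0Semigroup.apply_zero (hT : IsC0Semigroup T) (z : Z) : T 0 z = z := by
  rw [hT.zero, ContinuousLinearMap.id_apply]

theorem IsC0Semigroup.norm_le_mul_pow_floor (hT : IsC0Semigroup T) {M t₀ : ℝ} (ht₀ : 0 < t₀)
    (hM : ∀ t ∈ Icc 0 t₀, ‖T t‖ ≤ M) {t : ℝ} (ht : 0 ≤ t) :
    ‖T t‖ ≤ M * ‖T t₀‖ ^ ⌊t / t₀⌋₊ := by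
  have bound_add (n : ℕ) {r : ℝ} (hr : r ∈ Icc 0 t₀) : ‖T (n * t₀ + r)‖ ≤ M * ‖T t₀‖ ^ n := by
    induction n with
    | zero => simpa using hM r hr
    | succ n ih =>
      have hsucc : ((n + 1 : ℕ) : ℝ) * t₀ + r = t₀ + (n * t₀ + r) := by push_cast; ring
      rw [hsucc, hT.add _ _ ht₀.le (add_nonneg (by positivity) hr.1)]
      calc ‖(T t₀).comp (T (n * t₀ + r))‖ ≤ ‖T t₀‖ * ‖T (n * t₀ + r)‖ :=
            ContinuousLinearMap.opNorm_comp_le _ _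
        _ ≤ ‖T t₀‖ * (M * ‖T t₀‖ ^ n) := by gcongr
        _ = M * ‖T t₀‖ ^ (n + 1) := by ring
  have floor_le := (le_div_iff₀ ht₀).1 (Nat.floor_le (div_nonneg ht ht₀.le))
  have le_floor := (div_le_iff₀ ht₀).1 (Nat.lt_floor_add_one (t / t₀)).le
  simpa using bound_add ⌊t / t₀⌋₊ (r := t - ⌊t / t₀⌋₊ * t₀) ⟨by linarith, by linarith⟩

variable [CompleteSpace Z]

theorem IsC0Semigroup.exists_norm_le_Icc (hT : IsC0Semigroup T) (b : ℝ) :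
    ∃ M : ℝ, 0 < M ∧ ∀ t ∈ Icc 0 b, ‖T t‖ ≤ M := by
  obtain ⟨M, hM⟩ := banach_steinhaus (g := fun t : Icc (0 : ℝ) b => T t) fun z => by
    obtain ⟨c, hc⟩ := isCompact_Icc.exists_bound_of_continuousOn
      ((hT.continuousOn z).mono (Icc_subset_Ici_self : Icc 0 b ⊆ Ici 0))
    exact ⟨c, fun t => hc t t.2⟩
  exact ⟨max M 1, by positivity, fun t ht => (hM ⟨t, ht⟩).trans (le_max_left _ _)⟩

theorem IsC0Semigroup.exists_norm_le_exp (hT : IsC0Semigroup T) :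
    ∃ M ω : ℝ, 0 < M ∧ ∀ t, 0 ≤ t → ‖T t‖ ≤ M * Real.exp (ω * t) := by
  obtain ⟨M, hM, hTM⟩ := hT.exists_norm_le_Icc 1
  refine ⟨M, ‖T 1‖, hM, fun t ht => ?_⟩
  calc ‖T t‖ ≤ M * ‖T 1‖ ^ ⌊t / 1⌋₊ := hT.norm_le_mul_pow_floor one_pos hTM ht
    _ ≤ M * Real.exp ‖T 1‖ ^ ⌊t⌋₊ := by
      rw [div_one]
      gcongr
      linarith [Real.add_one_le_exp ‖T 1‖]
    _ ≤ M * Real.exp (‖T 1‖ * t) := by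
      rw [← Real.exp_nat_mul, mul_comm (_ : ℝ) ‖T 1‖]
      gcongr
      exact Nat.floor_le ht

theorem IsC0Semigroup.isExpStable_of_norm_lt_one (hT : IsC0Semigroup T) {t₀ : ℝ} (ht₀ : 0 < t₀)
    (hlt : ‖T t₀‖ < 1) : IsExpStable T := by
  obtain ⟨M, hM, hTM⟩ := hT.exists_norm_le_Icc t₀
  set c := 1 - ‖T t₀‖
  have : 0 < c := sub_pos.2 hlt
  refine ⟨M * Real.exp c, c / t₀, by positivity, by positivity, fun t ht => ?_⟩
  have hfloor : t / t₀ - 1 ≤ ⌊t / t₀⌋₊ := (Nat.sub_one_lt_floor _).le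
  calc ‖T t‖ ≤ M * ‖T t₀‖ ^ ⌊t / t₀⌋₊ := hT.norm_le_mul_pow_floor ht₀ hTM ht
    _ ≤ M * Real.exp (-c) ^ ⌊t / t₀⌋₊ := by
      gcongr
      linarith [Real.add_one_le_exp (-c)]
    _ ≤ M * Real.exp (c + -(c / t₀) * t) := by
      rw [← Real.exp_nat_mul]
      gcongr
      linear_combination c * hfloor
    _ = M * Real.exp c * Real.exp (-(c / t₀) * t) := by rw [Real.exp_add, mul_assoc]

theorem IsC0Semigroup.exists_eventually_norm_le (hT : IsC0Semigroup T) (t : ℝ) :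
    ∃ M, ∀ᶠ s in 𝓝[Ici 0] t, ‖T s‖ ≤ M := by
  obtain ⟨M, -, hM⟩ := hT.exists_norm_le_Icc (t + 1)
  refine ⟨M, ?_⟩
  filter_upwards [self_mem_nhdsWithin, mem_nhdsWithin_of_mem_nhds (Iic_mem_nhds (lt_add_one t))]
    with s hs0 hst using hM s ⟨hs0, hst⟩

theorem IsC0Semigroup.continuousOn_uncurry (hT : IsC0Semigroup T) :
    ContinuousOn (fun p : ℝ × Z => T p.1 p.2) (Ici 0 ×ˢ univ) :=
  continuousOn_clm_apply_of_dense (fun t _ => hT.exists_eventually_norm_le t) dense_univ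
    fun z _ => hT.continuousOn z

theorem IsC0Semigroup.continuousOn_apply (hT : IsC0Semigroup T) {X : Type*} [TopologicalSpace X]
    {s : Set X} {f : X → ℝ} {g : X → Z} (hf : ContinuousOn f s) (hg : ContinuousOn g s)
    (hf0 : ∀ x ∈ s, 0 ≤ f x) : ContinuousOn (fun x => T (f x) (g x)) s :=
  hT.continuousOn_uncurry.comp (hf.prodMk hg) fun x hx => ⟨hf0 x hx, trivial⟩

end Semigroup

section MildSolution

variable {Z : Type*} [NormedAddCommGroup Z] [InnerProductSpace ℝ Z]
  {T : ℝ → Z →L[ℝ] Z} {g v : ℝ → Z}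

/-- The convolution `∫₀ᵗ T (t - s) (g s) ds` of a semigroup with an inhomogeneity, that is, the
mild solution of `v' = A v + g`, `v 0 = 0`. -/
noncomputable def mildIntegral (T : ℝ → Z →L[ℝ] Z) (g : ℝ → Z) (t : ℝ) : Z :=
  ∫ s in (0 : ℝ)..t, T (t - s) (g s)

theorem mildIntegral_eq_smul_integral (T : ℝ → Z →L[ℝ] Z) (g : ℝ → Z) (t : ℝ) :
    mildIntegral T g t = t • ∫ q in (0 : ℝ)..1, T (t - t * q) (g (t * q)) := by
  rw [intervalIntegral.smul_integral_comp_mul_left (fun s => T (t - s) (g s)), mul_zero, mul_one,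
    mildIntegral]

/-- `HasForcingAt T v y s` says that the trajectory `v` satisfies `v' = A v + y` at time `s` to
first order, `A` being the generator of `T`. It is stated through `T` rather than `A`, so that it
makes sense for mild solutions, whose values may lie outside the domain of `A`. -/
def HasForcingAt (T : ℝ → Z →L[ℝ] Z) (v : ℝ → Z) (y : Z) (s : ℝ) : Prop :=
  Tendsto (fun r : ℝ => r⁻¹ • (v (s + r) - T r (v s))) (𝓝[>] 0) (𝓝 y)

theorem HasForcingAt.change_semigroup {T' : ℝ → Z →L[ℝ] Z} {y w : Z} {s : ℝ}
    (hv : HasForcingAt T v y s) (hT' : IsC0Semigroup T')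
    (hw : HasForcingAt T (fun r => T' r (v s)) w 0) : HasForcingAt T' v (y - w) s := by
  refine (hv.sub hw).congr fun r => ?_
  simp only [zero_add, hT'.apply_zero, ← smul_sub, sub_sub_sub_cancel_right]

variable [CompleteSpace Z]

theorem IsC0Semigroup.continuousOn_integral_rescaled (hT : IsC0Semigroup T)
    (hg : ContinuousOn g (Ici 0)) :
    ContinuousOn (fun t => ∫ q in (0 : ℝ)..1, T (t - t * q) (g (t * q))) (Ici 0) := by
  refine continuousOn_intervalIntegral_of_continuousOn zero_le_one
    (hT.continuousOn_apply (by fun_prop) (hg.comp (by fun_prop) ?_) ?_)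
  · exact fun p hp => mul_nonneg hp.1 hp.2.1
  · exact fun p hp => sub_nonneg.2 (mul_le_of_le_one_right hp.1 hp.2.2)

theorem IsC0Semigroup.continuousOn_mildIntegral (hT : IsC0Semigroup T)
    (hg : ContinuousOn g (Ici 0)) : ContinuousOn (mildIntegral T g) (Ici 0) :=
  (continuousOn_id.smul (hT.continuousOn_integral_rescaled hg)).congr
    fun t _ => mildIntegral_eq_smul_integral T g t

theorem IsC0Semigroup.tendsto_inv_smul_mildIntegral (hT : IsC0Semigroup T)
    (hg : ContinuousOn g (Ici 0)) :
    Tendsto (fun r : ℝ => r⁻¹ • mildIntegral T g r) (𝓝[>] 0) (𝓝 (g 0)) := by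
  have hcont := (hT.continuousOn_integral_rescaled hg 0 self_mem_Ici).mono Ioi_subset_Ici_self
  simp only [ContinuousWithinAt, zero_mul, sub_zero, hT.apply_zero,
    intervalIntegral.integral_const, one_smul] at hcont
  refine hcont.congr' (eventually_mem_nhdsWithin.mono fun r (hr : 0 < r) => ?_)
  simp only [mildIntegral_eq_smul_integral, inv_smul_smul₀ hr.ne']

theorem IsC0Semigroup.intervalIntegrable_conv (hT : IsC0Semigroup T)
    (hg : ContinuousOn g (Ici 0)) {a b t : ℝ} (ha : 0 ≤ a) (hab : a ≤ b) (hb : b ≤ t) :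
    IntervalIntegrable (fun s => T (t - s) (g s)) volume a b :=
  ContinuousOn.intervalIntegrable_of_Icc hab (hT.continuousOn_apply (by fun_prop)
    (hg.mono fun s hs => ha.trans hs.1) fun s hs => sub_nonneg.2 (hs.2.trans hb))

theorem IsC0Semigroup.mildIntegral_add (hT : IsC0Semigroup T) (hg : ContinuousOn g (Ici 0))
    {s r : ℝ} (hs : 0 ≤ s) (hr : 0 ≤ r) :
    mildIntegral T g (s + r) =
      T r (mildIntegral T g s) + mildIntegral T (fun τ => g (s + τ)) r := by
  have hsr : s ≤ s + r := le_add_of_nonneg_right hr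
  have past : ∫ τ in (0 : ℝ)..s, T (s + r - τ) (g τ) = T r (mildIntegral T g s) := by
    rw [mildIntegral, ← ContinuousLinearMap.intervalIntegral_comp_comm _
      (hT.intervalIntegrable_conv hg le_rfl hs le_rfl)]
    refine intervalIntegral.integral_congr fun τ hτ => ?_
    rw [uIcc_of_le hs] at hτ
    simp only [← hT.apply_add hr (sub_nonneg.2 hτ.2)]
    congr 2
    ring
  have future : ∫ τ in s..s + r, T (s + r - τ) (g τ) = mildIntegral T (fun τ => g (s + τ)) r := by
    simpa only [mildIntegral, add_sub_add_left_eq_sub, add_zero] using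
      (intervalIntegral.integral_comp_add_left (a := 0) (b := r)
        (fun τ => T (s + r - τ) (g τ)) s).symm
  rw [← past, ← future, mildIntegral, intervalIntegral.integral_add_adjacent_intervals
    (hT.intervalIntegrable_conv hg le_rfl hs hsr) (hT.intervalIntegrable_conv hg hs hsr le_rfl)]

omit [CompleteSpace Z] in
theorem IsMildSolution.apply_zero {f : ℝ → Z → Z} {v₀ : Z} (hT : IsC0Semigroup T)
    (hv : IsMildSolution T f v₀ v) : v 0 = v₀ := by
  rw [hv.2 0 le_rfl, intervalIntegral.integral_same, add_zero, hT.apply_zero]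

omit [CompleteSpace Z] in
theorem IsMildSolution.eq_apply {v₀ : Z} {t : ℝ}
    (hv : IsMildSolution T (fun _ _ => 0) v₀ v) (ht : 0 ≤ t) : v t = T t v₀ := by
  simpa using hv.2 t ht

omit [CompleteSpace Z] in
theorem IsMildSolution.congr_forcing {f g : ℝ → Z → Z} {v₀ : Z} (hv : IsMildSolution T f v₀ v)
    (hfg : ∀ s, 0 ≤ s → f s (v s) = g s (v s)) : IsMildSolution T g v₀ v := by
  refine ⟨hv.1, fun t ht => ?_⟩
  rw [hv.2 t ht, intervalIntegral.integral_congr fun τ hτ => ?_]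
  simp only [hfg τ (uIcc_of_le ht ▸ hτ).1]

omit [CompleteSpace Z] in
theorem IsMildSolution.congr {f : ℝ → Z → Z} {v₀ : Z} {w : ℝ → Z} (hv : IsMildSolution T f v₀ v)
    (hwv : EqOn w v (Ici 0)) : IsMildSolution T f v₀ w := by
  refine ⟨hv.1.congr hwv, fun t ht => ?_⟩
  rw [hwv ht, hv.2 t ht, intervalIntegral.integral_congr fun τ hτ => ?_]
  simp only [hwv (mem_Ici.2 (uIcc_of_le ht ▸ hτ).1)]

theorem IsMildSolution.apply_add {f : ℝ → Z → Z} {v₀ : Z} (hT : IsC0Semigroup T)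
    (hv : IsMildSolution T f v₀ v) (hf : ContinuousOn (fun s => f s (v s)) (Ici 0)) {s r : ℝ}
    (hs : 0 ≤ s) (hr : 0 ≤ r) :
    v (s + r) = T r (v s) + mildIntegral T (fun τ => f (s + τ) (v (s + τ))) r := by
  have hvt (t : ℝ) (ht : 0 ≤ t) : v t = T t v₀ + mildIntegral T (fun s => f s (v s)) t := hv.2 t ht
  rw [hvt s hs, hvt (s + r) (add_nonneg hs hr), hT.mildIntegral_add hf hs hr, add_comm s r,
    hT.apply_add hr hs, map_add, add_assoc]

theorem IsMildSolution.comp_add_left {f : Z → Z} {v₀ : Z} (hT : IsC0Semigroup T)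
    (hv : IsMildSolution T (fun _ => f) v₀ v) (hf : Continuous f) {s : ℝ} (hs : 0 ≤ s) :
    IsMildSolution T (fun _ => f) (v s) (fun r => v (s + r)) :=
  ⟨hv.1.comp (by fun_prop) fun _ hr => add_nonneg hs hr,
    fun _ hr => hv.apply_add hT (hf.comp_continuousOn hv.1) hs hr⟩

theorem IsMildSolution.hasForcingAt {f : ℝ → Z → Z} {v₀ : Z} (hT : IsC0Semigroup T)
    (hv : IsMildSolution T f v₀ v) (hf : ContinuousOn (fun s => f s (v s)) (Ici 0)) {s : ℝ}
    (hs : 0 ≤ s) : HasForcingAt T v (f s (v s)) s := by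
  have hfs : ContinuousOn (fun r => f (s + r) (v (s + r))) (Ici 0) :=
    hf.comp (f := fun r => s + r) (by fun_prop) fun r hr => add_nonneg hs hr
  have hlim := hT.tendsto_inv_smul_mildIntegral hfs
  rw [add_zero] at hlim
  refine hlim.congr' (eventually_mem_nhdsWithin.mono fun r (hr : 0 < r) => ?_)
  simp only [hv.apply_add hT hf hs hr.le, add_sub_cancel_left]

theorem HasForcingAt.hasDerivWithinAt_conv {y : Z} {s t : ℝ} (hv : HasForcingAt T v y s)
    (hT : IsC0Semigroup T) (hst : s < t) :
    HasDerivWithinAt (fun τ => T (t - τ) (v τ)) (T (t - s) y) (Ioi s) s := by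
  apply hasDerivWithinAt_Ioi_of_tendsto
  have hpair : Tendsto (fun r : ℝ => (t - s - r, r⁻¹ • (v (s + r) - T r (v s)))) (𝓝[>] 0)
      (𝓝[Ici 0 ×ˢ univ] (t - s, y)) := by
    refine tendsto_nhdsWithin_iff.2 ⟨Tendsto.prodMk_nhds ?_ hv, ?_⟩
    · exact ((continuous_sub_left (t - s)).tendsto' 0 _ (sub_zero _)).mono_left nhdsWithin_le_nhds
    · filter_upwards [Ioc_mem_nhdsGT (sub_pos.2 hst)] with r hr
      exact ⟨sub_nonneg.2 hr.2, trivial⟩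
  refine ((hT.continuousOn_uncurry (t - s, y) ⟨sub_nonneg.2 hst.le, trivial⟩).tendsto.comp
    hpair).congr' ?_
  filter_upwards [Ioc_mem_nhdsGT (sub_pos.2 hst)] with r hr
  rw [Function.comp_apply, map_smul, map_sub, ← hT.apply_add (sub_nonneg.2 hr.2) hr.1.le,
    sub_add_cancel, sub_sub]

theorem isMildSolution_of_hasForcingAt (hT : IsC0Semigroup T) (hv : ContinuousOn v (Ici 0))
    (hg : ContinuousOn g (Ici 0)) (hvg : ∀ s, 0 ≤ s → HasForcingAt T v (g s) s) :
    IsMildSolution T (fun s _ => g s) (v 0) v := by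
  refine ⟨hv, fun t ht => ?_⟩
  have hcont : ContinuousOn (fun s => T (t - s) (v s)) (Icc 0 t) :=
    hT.continuousOn_apply (by fun_prop) (hv.mono Icc_subset_Ici_self) fun s hs => sub_nonneg.2 hs.2
  rw [intervalIntegral.integral_eq_sub_of_hasDeriv_right_of_le ht hcont
    (fun s hs => (hvg s hs.1.le).hasDerivWithinAt_conv hT hs.2)
    (hT.intervalIntegrable_conv hg le_rfl ht le_rfl)]
  rw [sub_self, hT.apply_zero, sub_zero, add_sub_cancel]

theorem IsMildSolution.variation_of_constants {S : ℝ → Z →L[ℝ] Z} {G : Z →L[ℝ] Z} {v₀ : Z}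
    (hS : IsC0Semigroup S) (hT : IsC0Semigroup T)
    (hST : ∀ z, IsMildSolution S (fun _ => G) z (fun t => T t z)) (hg : ContinuousOn g (Ici 0))
    (hv : IsMildSolution S (fun s z => G z + g s) v₀ v) :
    IsMildSolution T (fun s _ => g s) v₀ v := by
  rw [← hv.apply_zero hS]
  have hGv : ContinuousOn (fun s => G (v s) + g s) (Ici 0) :=
    (G.continuous.comp_continuousOn hv.1).add hg
  refine isMildSolution_of_hasForcingAt hT hv.1 hg fun s hs => ?_
  have horbit := (hST (v s)).hasForcingAt hS
    (G.continuous.comp_continuousOn (hT.continuousOn _)) le_rfl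
  rw [hT.apply_zero] at horbit
  simpa only [add_sub_cancel_left] using (hv.hasForcingAt hS hGv hs).change_semigroup hT horbit

end MildSolution

section ExponentialDecay

variable {Z : Type*} [NormedAddCommGroup Z] [InnerProductSpace ℝ Z]
  {T : ℝ → Z →L[ℝ] Z} {M b t : ℝ} {g : ℝ → ℝ}

/-- The decay estimate `‖T t‖ ≤ M e^{-b t}` of `IsExpStable`, with its constants named. -/
structure HasExpDecay (T : ℝ → Z →L[ℝ] Z) (M b : ℝ) : Prop where
  const_pos : 0 < M
  rate_pos : 0 < b
  norm_le : ∀ t, 0 ≤ t → ‖T t‖ ≤ M * Real.exp (-b * t)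

theorem IsExpStable.exists_hasExpDecay (hT : IsExpStable T) : ∃ M b, HasExpDecay T M b := by
  obtain ⟨M, b, hM, hb, hTb⟩ := hT
  exact ⟨M, b, hM, hb, hTb⟩

theorem HasExpDecay.norm_apply_le (hT : HasExpDecay T M b) (ht : 0 ≤ t) (z : Z) :
    ‖T t z‖ ≤ M * (Real.exp (-b * t) * ‖z‖) := by
  rw [← mul_assoc]
  exact (T t).le_of_opNorm_le (hT.norm_le t ht) z

theorem HasExpDecay.norm_apply_le_const (hT : HasExpDecay T M b) (ht : 0 ≤ t) (z : Z) :
    ‖T t z‖ ≤ M * ‖z‖ := by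
  have hexp : Real.exp (-b * t) ≤ 1 :=
    Real.exp_le_one_iff.2 (mul_nonpos_of_nonpos_of_nonneg (neg_nonpos.2 hT.rate_pos.le) ht)
  have := hT.const_pos
  calc ‖T t z‖ ≤ M * (Real.exp (-b * t) * ‖z‖) := hT.norm_apply_le ht z
    _ ≤ M * (1 * ‖z‖) := by gcongr
    _ = M * ‖z‖ := by rw [one_mul]

/-- The solution `∫₀ᵗ e^{-b (t - s)} g(s) ds` of the scalar equation `x' = -b x + g`, `x(0) = 0`,
which majorizes mild solutions of exponentially stable systems. -/
noncomputable def expConv (b : ℝ) (g : ℝ → ℝ) (t : ℝ) : ℝ :=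
  ∫ s in (0 : ℝ)..t, Real.exp (-b * (t - s)) * g s

theorem expConv_eq_exp_mul (b : ℝ) (g : ℝ → ℝ) (t : ℝ) :
    expConv b g t = Real.exp (-b * t) * ∫ s in (0 : ℝ)..t, Real.exp (b * s) * g s := by
  rw [expConv, ← intervalIntegral.integral_const_mul]
  refine intervalIntegral.integral_congr fun s _ => ?_
  simp only [← mul_assoc, ← Real.exp_add]
  ring_nf

theorem hasDerivAt_expConv (hg : Continuous g) (b t : ℝ) :
    HasDerivAt (expConv b g) (-b * expConv b g t + g t) t := by
  have hexp : HasDerivAt (fun t => Real.exp (-b * t)) (Real.exp (-b * t) * -b) t := by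
    simpa only [id_eq, mul_one] using ((hasDerivAt_id t).const_mul (-b)).exp
  have hint : HasDerivAt (fun t => ∫ s in (0 : ℝ)..t, Real.exp (b * s) * g s)
      (Real.exp (b * t) * g t) t :=
    intervalIntegral.integral_hasDerivAt_right (Continuous.intervalIntegrable (by fun_prop) _ _)
      (Continuous.stronglyMeasurableAtFilter (by fun_prop) _ _) (by fun_prop)
  have hcancel : Real.exp (-b * t) * Real.exp (b * t) = 1 := by
    rw [← Real.exp_add, neg_mul, neg_add_cancel, Real.exp_zero]
  rw [funext (expConv_eq_exp_mul b g)]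
  exact (hexp.fun_mul hint).congr_deriv (by linear_combination g t * hcancel)

theorem expConv_le {k : ℝ} (hg : ContinuousOn g (Icc 0 t)) (hk : ∀ s ∈ Icc 0 t, g s ≤ k)
    (hk0 : 0 ≤ k) (hb : 0 < b) (ht : 0 ≤ t) : expConv b g t ≤ k / b := by
  have hderiv (s : ℝ) : HasDerivAt (fun s => Real.exp (-b * (t - s)) * (k / b))
      (Real.exp (-b * (t - s)) * k) s := by
    have hlin : HasDerivAt (fun s : ℝ => -b * (t - s)) b s := by
      simpa using ((hasDerivAt_id s).const_sub t).const_mul (-b)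
    exact (hlin.exp.mul_const (k / b)).congr_deriv (by field_simp)
  have hcont : Continuous fun s => Real.exp (-b * (t - s)) * k := by fun_prop
  calc expConv b g t ≤ ∫ s in (0 : ℝ)..t, Real.exp (-b * (t - s)) * k :=
        intervalIntegral.integral_mono_on ht
          (ContinuousOn.intervalIntegrable_of_Icc ht (by fun_prop))
          (hcont.intervalIntegrable _ _)
          fun s hs => mul_le_mul_of_nonneg_left (hk s hs) (Real.exp_pos _).le
    _ = k / b - Real.exp (-b * t) * (k / b) := by
        rw [intervalIntegral.integral_eq_sub_of_hasDerivAt (fun s _ => hderiv s)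
          (hcont.intervalIntegrable _ _)]
        simp
    _ ≤ k / b := sub_le_self _ (by positivity)

theorem HasExpDecay.norm_mildIntegral_le_expConv (hT : HasExpDecay T M b) {f : ℝ → Z}
    (hf : ContinuousOn f (Icc 0 t)) (ht : 0 ≤ t) :
    ‖mildIntegral T f t‖ ≤ M * expConv b (fun s => ‖f s‖) t := by
  rw [expConv, ← intervalIntegral.integral_const_mul]
  exact intervalIntegral.norm_integral_le_of_norm_le ht
    (Eventually.of_forall fun s hs => hT.norm_apply_le (sub_nonneg.2 hs.2) (f s))
    (ContinuousOn.intervalIntegrable_of_Icc ht (by fun_prop))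

theorem HasExpDecay.norm_mildIntegral_le (hT : HasExpDecay T M b) {f : ℝ → Z} {k : ℝ}
    (hf : ContinuousOn f (Icc 0 t)) (ht : 0 ≤ t) (hk : ∀ s ∈ Icc 0 t, ‖f s‖ ≤ k) :
    ‖mildIntegral T f t‖ ≤ M / b * k := by
  have hk0 : 0 ≤ k := (norm_nonneg _).trans (hk 0 ⟨le_rfl, ht⟩)
  calc ‖mildIntegral T f t‖ ≤ M * expConv b (fun s => ‖f s‖) t :=
        hT.norm_mildIntegral_le_expConv hf ht
    _ ≤ M * (k / b) :=
        mul_le_mul_of_nonneg_left (expConv_le hf.norm hk hk0 hT.rate_pos ht) hT.const_pos.le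
    _ = M / b * k := by ring

end ExponentialDecay

section BoundedPerturbation

theorem exists_clm_eq_add_iff {E : Type*} [NormedAddCommGroup E] [NormedSpace ℝ E]
    [CompleteSpace E] {Φ : E →L[ℝ] E} (hΦ : ‖Φ‖ < 1) :
    ∃ N : E →L[ℝ] E, ∀ w f, w = N f ↔ w = f + Φ w := by
  let V := ContinuousLinearEquiv.unitsEquiv ℝ E (Units.oneSub Φ hΦ)
  have hV (w : E) : V w = w - Φ w := rfl
  refine ⟨V.symm, fun w f => ?_⟩
  rw [← sub_eq_iff_eq_add, ← hV]
  exact V.toEquiv.eq_symm_apply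

theorem exists_boundedContinuousFunction_clm {E F X : Type*} [NormedAddCommGroup E]
    [NormedSpace ℝ E] [NormedAddCommGroup F] [NormedSpace ℝ F] [TopologicalSpace X]
    (L : E →ₗ[ℝ] X → F) (hL : ∀ w, Continuous (L w)) {c : ℝ} (hc : 0 ≤ c)
    (hLc : ∀ w t, ‖L w t‖ ≤ c * ‖w‖) :
    ∃ Φ : E →L[ℝ] (X →ᵇ F), ‖Φ‖ ≤ c ∧ ∀ w t, Φ w t = L w t := by
  let Φ : E →ₗ[ℝ] (X →ᵇ F) :=
    { toFun := fun w => BoundedContinuousFunction.ofNormedAddCommGroup (L w) (hL w) _ (hLc w)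
      map_add' := fun w₁ w₂ => by ext t; simp
      map_smul' := fun r w => by ext t; simp }
  have hΦ (w : E) : ‖Φ w‖ ≤ c * ‖w‖ :=
    (BoundedContinuousFunction.norm_le (by positivity)).2 (hLc w)
  exact ⟨Φ.mkContinuous c hΦ, Φ.mkContinuous_norm_le hc hΦ, fun _ _ => rfl⟩

variable {Z : Type*} [NormedAddCommGroup Z] [InnerProductSpace ℝ Z] {T : ℝ → Z →L[ℝ] Z} {M b : ℝ}

theorem HasExpDecay.exists_orbit_clm (hT : HasExpDecay T M b) (hT₀ : IsC0Semigroup T) :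
    ∃ J : Z →L[ℝ] (ℝ≥0 →ᵇ Z), ∀ z (t : ℝ≥0), J z t = T t z := by
  obtain ⟨J, -, hJ⟩ := exists_boundedContinuousFunction_clm
    (LinearMap.pi fun t : ℝ≥0 => (T t : Z →ₗ[ℝ] Z))
    (fun z => (hT₀.continuousOn z).comp_continuous NNReal.continuous_coe fun t => t.2)
    hT.const_pos.le fun z t => hT.norm_apply_le_const t.2 z
  exact ⟨J, hJ⟩

variable [CompleteSpace Z]

theorem HasExpDecay.exists_mildIntegral_clm (hT : HasExpDecay T M b) (hT₀ : IsC0Semigroup T) :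
    ∃ Φ : (ℝ≥0 →ᵇ Z) →L[ℝ] (ℝ≥0 →ᵇ Z), ‖Φ‖ ≤ M / b ∧
      ∀ w (t : ℝ≥0), Φ w t = mildIntegral T (fun s => w s.toNNReal) t := by
  have hw (w : ℝ≥0 →ᵇ Z) : Continuous fun s : ℝ => w s.toNNReal :=
    w.continuous.comp continuous_real_toNNReal
  have hint (w : ℝ≥0 →ᵇ Z) (t : ℝ≥0) := hT₀.intervalIntegrable_conv (hw w).continuousOn
    le_rfl t.2 (le_refl (t : ℝ))
  let L : (ℝ≥0 →ᵇ Z) →ₗ[ℝ] ℝ≥0 → Z :=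
    { toFun := fun w t => mildIntegral T (fun s => w s.toNNReal) t
      map_add' := fun w₁ w₂ => funext fun t => by
        simp only [Pi.add_apply, mildIntegral, BoundedContinuousFunction.add_apply, map_add]
        exact intervalIntegral.integral_add (hint w₁ t) (hint w₂ t)
      map_smul' := fun c w => funext fun t => by
        simp only [Pi.smul_apply, mildIntegral, BoundedContinuousFunction.coe_smul, map_smul]
        exact intervalIntegral.integral_smul c _ }
  exact exists_boundedContinuousFunction_clm L
    (fun w => (hT₀.continuousOn_mildIntegral (hw w).continuousOn).comp_continuous
      NNReal.continuous_coe fun t => t.2)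
    (div_pos hT.const_pos hT.rate_pos).le
    fun w t => hT.norm_mildIntegral_le (hw w).continuousOn t.2 fun s _ => w.norm_coe_le_norm _

theorem HasExpDecay.exists_mildSolution_clm (hT : HasExpDecay T M b) (hT₀ : IsC0Semigroup T)
    {G : Z →L[ℝ] Z} (hG : M / b * ‖G‖ < 1) :
    ∃ N : Z →L[ℝ] (ℝ≥0 →ᵇ Z), ∀ z w,
      w = N z ↔ IsMildSolution T (fun _ => G) z (fun t => w t.toNNReal) := by
  obtain ⟨J, hJ⟩ := hT.exists_orbit_clm hT₀
  obtain ⟨Φ, hΦ, hΦ_apply⟩ := hT.exists_mildIntegral_clm hT₀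
  have hG' : ‖G.compLeftContinuousBounded ℝ≥0‖ ≤ ‖G‖ :=
    ContinuousLinearMap.opNorm_le_bound _ (norm_nonneg G) fun w : ℝ≥0 →ᵇ Z =>
      (BoundedContinuousFunction.norm_le (by positivity)).2 fun t =>
        G.le_opNorm_of_le (w.norm_coe_le_norm t)
  have hΦG : ‖Φ ∘L G.compLeftContinuousBounded ℝ≥0‖ < 1 :=
    ((Φ.opNorm_comp_le _).trans (mul_le_mul hΦ hG' (norm_nonneg _)
      (div_pos hT.const_pos hT.rate_pos).le)).trans_lt hG
  obtain ⟨N, hN⟩ := exists_clm_eq_add_iff hΦG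
  refine ⟨N ∘L J, fun z w => (hN w (J z)).trans ⟨fun h => ⟨?_, fun t ht => ?_⟩, fun h => ?_⟩⟩
  · exact (w.continuous.comp continuous_real_toNNReal).continuousOn
  · have := congrArg (fun w : ℝ≥0 →ᵇ Z => w t.toNNReal) h
    simpa [hJ, hΦ_apply, mildIntegral, Real.coe_toNNReal t ht] using this
  · ext t
    have := h.2 t t.2
    simpa [hJ, hΦ_apply, mildIntegral] using this

theorem HasExpDecay.exists_perturbation (hT : HasExpDecay T M b) (hT₀ : IsC0Semigroup T)
    {G : Z →L[ℝ] Z} (hG : M / b * ‖G‖ < 1) :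
    ∃ T' : ℝ → Z →L[ℝ] Z, IsC0Semigroup T' ∧
      ∀ z, IsMildSolution T (fun _ => G) z (fun t => T' t z) := by
  obtain ⟨N, hN⟩ := hT.exists_mildSolution_clm hT₀ hG
  let T' (t : ℝ) : Z →L[ℝ] Z := BoundedContinuousFunction.evalCLM ℝ t.toNNReal ∘L N
  have hmild (z : Z) : IsMildSolution T (fun _ => G) z (fun t => T' t z) := (hN z (N z)).1 rfl
  refine ⟨T', ⟨?_, fun s t hs ht => ?_, fun z => (hmild z).1⟩, hmild⟩
  · ext z
    exact (hmild z).apply_zero hT₀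
  · ext z
    let w := (N z).compContinuous ⟨fun r => t.toNNReal + r, by fun_prop⟩
    have hw : w = N (T' t z) := by
      refine (hN _ w).2 (((hmild z).comp_add_left hT₀ G.continuous ht).congr fun r hr => ?_)
      change N z (t.toNNReal + r.toNNReal) = N z (t + r).toNNReal
      rw [Real.toNNReal_add ht hr]
    rw [add_comm]
    change N z (t + s).toNNReal = N (T' t z) s.toNNReal
    rw [← hw, Real.toNNReal_add ht hs]
    rfl

/-- The exponentially rescaled semigroup `e^{c t} T t`, generated by `A + c`; for `c` negative
enough it is exponentially stable. -/
noncomputable def expScale (c : ℝ) (T : ℝ → Z →L[ℝ] Z) (t : ℝ) : Z →L[ℝ] Z := Real.exp (c * t) • T t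

omit [CompleteSpace Z] in
theorem isC0Semigroup_expScale (hT : IsC0Semigroup T) (c : ℝ) : IsC0Semigroup (expScale c T) where
  zero := by simp [expScale, hT.zero]
  add s t hs ht := by
    simp only [expScale, mul_add, Real.exp_add, hT.add s t hs ht,
      ContinuousLinearMap.smul_comp, ContinuousLinearMap.comp_smul, smul_smul, mul_comm]
  continuousOn z := ContinuousOn.smul (by fun_prop) (hT.continuousOn z)

omit [CompleteSpace Z] in
theorem IsMildSolution.exp_smul {c : ℝ} {G : Z →L[ℝ] Z} {v₀ : Z} {v : ℝ → Z}
    (hv : IsMildSolution (expScale c T) (fun _ => G) v₀ v) :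
    IsMildSolution T (fun _ => G) v₀ (fun t => Real.exp (-c * t) • v t) := by
  refine ⟨ContinuousOn.smul (by fun_prop) hv.1, fun t ht => ?_⟩
  have hexp (s : ℝ) : Real.exp (-c * t) * Real.exp (c * (t - s)) = Real.exp (-c * s) := by
    rw [← Real.exp_add]
    ring_nf
  simp only
  rw [hv.2 t ht, smul_add, ← intervalIntegral.integral_smul]
  simp only [expScale, _root_.smul_apply, smul_smul, hexp, map_smul]
  simpa using congrArg (· • T t v₀) (hexp 0)

theorem IsC0Semigroup.exists_perturbation (hT : IsC0Semigroup T) (G : Z →L[ℝ] Z) :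
    ∃ T' : ℝ → Z →L[ℝ] Z, IsC0Semigroup T' ∧
      ∀ z, IsMildSolution T (fun _ => G) z (fun t => T' t z) := by
  obtain ⟨M, ω, hM, hTM⟩ := hT.exists_norm_le_exp
  have hrate : 0 < M * ‖G‖ + 1 := by positivity
  -- Rescaling so that the decay rate exceeds `M ‖G‖` makes the fixed point map a contraction.
  set c := -(ω + (M * ‖G‖ + 1)) with hc
  have hdecay : HasExpDecay (expScale c T) M (M * ‖G‖ + 1) := by
    refine ⟨hM, hrate, fun t ht => ?_⟩
    rw [expScale, norm_smul, Real.norm_of_nonneg (Real.exp_pos _).le]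
    calc Real.exp (c * t) * ‖T t‖ ≤ Real.exp (c * t) * (M * Real.exp (ω * t)) := by
          gcongr
          exact hTM t ht
      _ = M * Real.exp (-(M * ‖G‖ + 1) * t) := by
          rw [mul_left_comm, ← Real.exp_add, ← add_mul, hc]
          ring_nf
  obtain ⟨T', hT', hmild⟩ := hdecay.exists_perturbation (isC0Semigroup_expScale hT c) (G := G) (by
    rw [div_mul_eq_mul_div, div_lt_one hrate]
    exact lt_add_one _)
  exact ⟨expScale (-c) T', isC0Semigroup_expScale hT' (-c), fun z => (hmild z).exp_smul⟩

omit [CompleteSpace Z] in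
theorem mem_graph_boundedPerturbation_iff {A : Z →ₗ.[ℝ] Z} {G : Z →L[ℝ] Z} {z y : Z} :
    (z, y) ∈ (boundedPerturbation A G).graph ↔ (z, y - G z) ∈ A.graph := by
  simp only [LinearPMap.mem_graph_iff, boundedPerturbation]
  constructor
  · rintro ⟨x, rfl, hx⟩
    refine ⟨x, rfl, ?_⟩
    rw [← hx]
    simp [LinearPMap.vadd_apply]
  · rintro ⟨x, rfl, hx⟩
    refine ⟨x, rfl, ?_⟩
    rw [LinearPMap.vadd_apply, hx]
    simp

theorem Generates.exists_boundedPerturbation {A : Z →ₗ.[ℝ] Z} (hA : Generates A T)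
    (G : Z →L[ℝ] Z) : ∃ T', Generates (boundedPerturbation A G) T' := by
  obtain ⟨T', hT', hmild⟩ := hA.1.exists_perturbation G
  refine ⟨T', hT', fun z y => ?_⟩
  have hG : HasForcingAt T (fun t => T' t z) (G z) 0 := by
    simpa only [hT'.apply_zero] using (hmild z).hasForcingAt hA.1
      (G.continuous.comp_continuousOn (hT'.continuousOn z)) le_rfl
  simp only [HasForcingAt, zero_add, hT'.apply_zero] at hG
  rw [mem_graph_boundedPerturbation_iff, hA.2]
  refine ⟨fun h => ?_, fun h => ?_⟩
  · convert h.add hG using 2 with r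
    · rw [← smul_add, sub_add_sub_comm, add_comm, add_sub_add_right_eq_sub]
    · rw [sub_add_cancel]
  · refine (h.sub hG).congr fun r => ?_
    rw [← smul_sub, sub_sub_sub_cancel_left]

end BoundedPerturbation

section Domain

variable {Z : Type*} [NormedAddCommGroup Z] [InnerProductSpace ℝ Z] {A : Z →ₗ.[ℝ] Z}
  {G : Z →L[ℝ] Z} {T T' : ℝ → Z →L[ℝ] Z} {z y : Z} {t h : ℝ}

theorem IsC0Semigroup.intervalIntegrable (hT : IsC0Semigroup T) {a b : ℝ} (ha : 0 ≤ a)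
    (hb : 0 ≤ b) (z : Z) : IntervalIntegrable (fun s => T s z) volume a b :=
  ((hT.continuousOn z).mono fun _ hs => (le_min ha hb).trans hs.1).intervalIntegrable

theorem IsC0Semigroup.integral_apply (hT : IsC0Semigroup T) (ht : 0 ≤ t) (hh : 0 ≤ h) (z : Z) :
    ∫ s in (0 : ℝ)..h, T s (T t z) = ∫ s in t..h + t, T s z := by
  nth_rewrite 2 [← zero_add t]
  rw [← intervalIntegral.integral_comp_add_right]
  refine intervalIntegral.integral_congr fun s hs => ?_
  rw [uIcc_of_le hh] at hs
  exact (hT.apply_add hs.1 ht z).symm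

theorem Generates.apply_mem_graph (hA : Generates A T) (hz : (z, y) ∈ A.graph) (ht : 0 ≤ t) :
    (T t z, T t y) ∈ A.graph := by
  refine (hA.2 _ _).2 ((((T t).continuous.tendsto _).comp ((hA.2 z y).1 hz)).congr' ?_)
  filter_upwards [self_mem_nhdsWithin] with r (hr : 0 < r)
  rw [Function.comp_apply, map_smul, map_sub, ← hA.1.apply_add ht hr.le,
    ← hA.1.apply_add hr.le ht, add_comm]

theorem Generates.hasDerivWithinAt_apply (hA : Generates A T) (hz : (z, y) ∈ A.graph)
    (ht : 0 ≤ t) : HasDerivWithinAt (fun t => T t z) (T t y) (Ioi t) t := by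
  refine hasDerivWithinAt_Ioi_of_tendsto
    (((hA.2 _ _).1 (hA.apply_mem_graph hz ht)).congr' ?_)
  filter_upwards [self_mem_nhdsWithin] with r (hr : 0 < r)
  rw [add_comm, hA.1.apply_add hr.le ht]

theorem Generates.hasForcingAt (hA : Generates A T)
    (hA' : Generates (boundedPerturbation A G) T') (hz : z ∈ A.domain) (ht : 0 ≤ t) :
    HasForcingAt T (fun s => T' s z) (G (T' t z)) t := by
  obtain ⟨y, hzy⟩ : ∃ y, (z, y) ∈ (boundedPerturbation A G).graph :=
    ⟨A ⟨z, hz⟩ + G z, mem_graph_boundedPerturbation_iff.2 (by simpa using A.mem_graph ⟨z, hz⟩)⟩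
  have hty := hA'.apply_mem_graph hzy ht
  have hlim := ((hA'.2 _ _).1 hty).sub ((hA.2 _ _).1 (mem_graph_boundedPerturbation_iff.1 hty))
  rw [sub_sub_cancel] at hlim
  refine hlim.congr' ?_
  filter_upwards [self_mem_nhdsWithin] with r (hr : 0 < r)
  rw [← smul_sub, sub_sub_sub_cancel_right, add_comm t r, hA'.1.apply_add hr.le ht]

theorem boundedPerturbation_boundedPerturbation (A : Z →ₗ.[ℝ] Z) (G G' : Z →L[ℝ] Z) :
    boundedPerturbation (boundedPerturbation A G) G' = boundedPerturbation A (G + G') := by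
  simp only [boundedPerturbation, vadd_vadd, ContinuousLinearMap.toLinearMap_add, add_comm]

variable [CompleteSpace Z]

theorem IsC0Semigroup.apply_integral (hT : IsC0Semigroup T) (ht : 0 ≤ t) (hh : 0 ≤ h) (z : Z) :
    T t (∫ s in (0 : ℝ)..h, T s z) = ∫ s in t..h + t, T s z := by
  rw [← hT.integral_apply ht hh, ← ContinuousLinearMap.intervalIntegral_comp_comm _
    (hT.intervalIntegrable le_rfl hh z)]
  refine intervalIntegral.integral_congr fun s hs => ?_
  rw [uIcc_of_le hh] at hs
  simp only [← hT.apply_add ht hs.1, ← hT.apply_add hs.1 ht, add_comm]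

theorem IsC0Semigroup.tendsto_inv_smul_integral (hT : IsC0Semigroup T) (z : Z) :
    Tendsto (fun h : ℝ => h⁻¹ • ∫ s in (0 : ℝ)..h, T s z) (𝓝[>] 0) (𝓝 z) := by
  refine (hT.tendsto_inv_smul_mildIntegral (g := fun _ => z) continuousOn_const).congr fun h => ?_
  rw [mildIntegral, intervalIntegral.integral_comp_sub_left (fun r => T r z), sub_zero, sub_self]

theorem Generates.integral_mem_domain (hA : Generates A T) (hh : 0 ≤ h) (z : Z) :
    ∫ s in (0 : ℝ)..h, T s z ∈ A.domain := by
  refine LinearPMap.mem_domain_of_mem_graph (y := T h z - z) ((hA.2 _ _).2 ?_)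
  have hT := hA.1
  refine ((hT.tendsto_inv_smul_integral (T h z)).sub (hT.tendsto_inv_smul_integral z)).congr' ?_
  filter_upwards [self_mem_nhdsWithin] with r (hr : 0 < r)
  have hint {a b : ℝ} (ha : 0 ≤ a) (hb : 0 ≤ b) := hT.intervalIntegrable ha hb z
  rw [← smul_sub, hT.integral_apply hh hr.le, hT.apply_integral hr.le hh,
    intervalIntegral.integral_interval_sub_interval_comm' (hint hh (add_nonneg hr.le hh))
      (hint le_rfl hr.le) (hint hh le_rfl), add_comm]

theorem Generates.dense_domain (hA : Generates A T) : Dense (A.domain : Set Z) := fun z =>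
  mem_closure_of_tendsto (hA.1.tendsto_inv_smul_integral z) <|
    eventually_mem_nhdsWithin.mono fun _ hh =>
      A.domain.smul_mem _ (hA.integral_mem_domain (le_of_lt hh) z)

theorem Generates.isMildSolution_boundedPerturbation (hA : Generates A T)
    (hA' : Generates (boundedPerturbation A G) T') (z : Z) :
    IsMildSolution T (fun _ => G) z (fun t => T' t z) := by
  refine ⟨hA'.1.continuousOn z, fun t ht => ?_⟩
  have hconv : Continuous fun z => ∫ s in (0 : ℝ)..t, T (t - s) (G (T' s z)) := by
    rw [← continuousOn_univ]
    refine continuousOn_intervalIntegral_of_continuousOn ht (hA.1.continuousOn_apply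
      (by fun_prop) (G.continuous.comp_continuousOn (hA'.1.continuousOn_apply
        continuousOn_snd continuousOn_fst ?_)) ?_)
    · exact fun p hp => hp.2.1
    · exact fun p hp => sub_nonneg.2 hp.2.2
  refine hA.dense_domain.induction (fun x hx => ?_)
    (isClosed_eq (by fun_prop) (by fun_prop)) z
  have hmild := isMildSolution_of_hasForcingAt hA.1 (hA'.1.continuousOn x)
    (G.continuous.comp_continuousOn (hA'.1.continuousOn x)) fun s hs => hA.hasForcingAt hA' hx hs
  rw [hA'.1.apply_zero] at hmild
  exact hmild.2 t ht

end Domain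

section Adjoint

variable {Z : Type*} [NormedAddCommGroup Z] [InnerProductSpace ℝ Z] [CompleteSpace Z]
  {T : ℝ → Z →L[ℝ] Z}

theorem IsC0Semigroup.exists_integral_clm (hT : IsC0Semigroup T) :
    ∃ J : ℝ → Z →L[ℝ] Z, ContinuousOn J (Ici 0) ∧
      ∀ h, 0 ≤ h → ∀ z, J h z = ∫ s in (0 : ℝ)..h, T s z := by
  have bound {b M : ℝ} (hM : ∀ t ∈ Icc 0 b, ‖T t‖ ≤ M) (z : Z) {s t : ℝ} (hs : s ∈ Icc 0 b)
      (ht : t ∈ Icc 0 b) : ‖∫ r in s..t, T r z‖ ≤ M * |t - s| * ‖z‖ := by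
    rw [mul_right_comm]
    refine intervalIntegral.norm_integral_le_of_norm_le_const fun r hr => ?_
    have hr' : r ∈ uIcc s t := uIoc_subset_uIcc hr
    exact (T r).le_of_opNorm_le (hM r (uIcc_subset_Icc hs ht hr')) z
  have exists_clm (h : ℝ) (hh : 0 ≤ h) :
      ∃ J : Z →L[ℝ] Z, ∀ z, J z = ∫ s in (0 : ℝ)..h, T s z := by
    obtain ⟨M, -, hM⟩ := hT.exists_norm_le_Icc h
    have hint := hT.intervalIntegrable le_rfl hh
    exact ⟨LinearMap.mkContinuous
      { toFun := fun z => ∫ s in (0 : ℝ)..h, T s z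
        map_add' := fun x y => by
          simpa only [map_add] using intervalIntegral.integral_add (hint x) (hint y)
        map_smul' := fun c x => by
          simp only [map_smul, RingHom.id_apply, intervalIntegral.integral_smul] }
      (M * |h - 0|) fun z => bound hM z ⟨le_rfl, hh⟩ ⟨hh, le_rfl⟩, fun z => rfl⟩
  choose! J hJ using exists_clm
  refine ⟨J, fun s hs => ?_, hJ⟩
  obtain ⟨M, hM0, hM⟩ := hT.exists_norm_le_Icc (s + 1)
  have hlip : LipschitzOnWith M.toNNReal J (Icc 0 (s + 1)) := by
    refine LipschitzOnWith.of_dist_le_mul fun t ht r hr => ?_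
    rw [dist_eq_norm, Real.coe_toNNReal M hM0.le, Real.dist_eq]
    refine ContinuousLinearMap.opNorm_le_bound _ (by positivity) fun z => ?_
    rw [sub_apply, hJ t ht.1, hJ r hr.1, intervalIntegral.integral_interval_sub_left
      (hT.intervalIntegrable le_rfl ht.1 z) (hT.intervalIntegrable le_rfl hr.1 z)]
    exact bound hM z hr ht
  refine (hlip.continuousOn s ⟨hs, (lt_add_one s).le⟩).mono_of_mem_nhdsWithin ?_
  exact inter_mem self_mem_nhdsWithin (mem_nhdsWithin_of_mem_nhds (Iic_mem_nhds (lt_add_one s)))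

theorem IsC0Semigroup.dense_iSup_range_adjoint (hT : IsC0Semigroup T) {J : ℝ → Z →L[ℝ] Z}
    (hJ : ∀ h, 0 ≤ h → ∀ z, J h z = ∫ s in (0 : ℝ)..h, T s z) :
    Dense ((⨆ h : Ici (0 : ℝ), (J h)†.range : Submodule ℝ Z) : Set Z) := by
  rw [Submodule.dense_iff_topologicalClosure_eq_top, Submodule.topologicalClosure_eq_top_iff,
    ← Submodule.iInf_orthogonal, Submodule.eq_bot_iff]
  intro w hw
  refine tendsto_nhds_unique (hT.tendsto_inv_smul_integral w) (tendsto_const_nhds.congr' ?_)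
  filter_upwards [self_mem_nhdsWithin] with h (hh : 0 < h)
  have hJw : J h w = 0 := by
    have := (Submodule.mem_iInf _).1 hw ⟨h, hh.le⟩
    rwa [ContinuousLinearMap.orthogonal_range, ContinuousLinearMap.adjoint_adjoint] at this
  rw [← hJ h hh.le, hJw, smul_zero]

theorem IsC0Semigroup.continuousOn_adjoint_apply_adjoint (hT : IsC0Semigroup T)
    {J : ℝ → Z →L[ℝ] Z} (hJc : ContinuousOn J (Ici 0))
    (hJ : ∀ h, 0 ≤ h → ∀ z, J h z = ∫ s in (0 : ℝ)..h, T s z) {h : ℝ} (hh : 0 ≤ h) (x : Z) :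
    ContinuousOn (fun t => ((T t)†) (((J h)†) x)) (Ici 0) := by
  have hJ_shift : ContinuousOn (fun t : ℝ => J (h + t)) (Ici 0) :=
    hJc.comp (by fun_prop) fun t (ht : 0 ≤ t) => add_nonneg hh ht
  -- `J h ∘ T t = J (h + t) - J t` is norm continuous in `t`, although `T t` is not.
  have hJT : ContinuousOn (fun t => ((J (h + t) - J t)†) x) (Ici 0) :=
    (ContinuousLinearMap.adjoint.continuous.comp_continuousOn (hJ_shift.sub hJc)).clm_apply
      continuousOn_const
  refine hJT.congr fun t ht => ?_
  have hcomp : J (h + t) - J t = J h ∘L T t := by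
    ext z
    rw [ContinuousLinearMap.comp_apply, sub_apply, hJ _ hh, hT.integral_apply ht hh,
      hJ _ (add_nonneg hh ht), hJ _ ht, intervalIntegral.integral_interval_sub_left
        (hT.intervalIntegrable le_rfl (add_nonneg hh ht) z) (hT.intervalIntegrable le_rfl ht z)]
  simp only [hcomp, ContinuousLinearMap.adjoint_comp, ContinuousLinearMap.comp_apply]

theorem isC0Semigroup_adjoint (hT : IsC0Semigroup T) : IsC0Semigroup fun t => (T t)† := by
  obtain ⟨J, hJc, hJ⟩ := hT.exists_integral_clm
  have hcont : ∀ y ∈ (⨆ h : Ici (0 : ℝ), (J h)†.range : Submodule ℝ Z),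
      ContinuousOn (fun t => ((T t)†) y) (Ici 0) := by
    intro y hy
    induction hy using Submodule.iSup_induction' with
    | mem h y hy =>
      obtain ⟨x, rfl⟩ := hy
      exact hT.continuousOn_adjoint_apply_adjoint hJc hJ h.2 x
    | zero => simpa only [map_zero] using continuousOn_const
    | add x y _ _ hx hy => simpa only [map_add] using hx.fun_add hy
  refine ⟨?_, fun s t hs ht => ?_, fun y => ?_⟩
  · rw [hT.zero]
    exact ContinuousLinearMap.adjoint_id
  · rw [add_comm, hT.add t s ht hs, ContinuousLinearMap.adjoint_comp]
  · refine (continuousOn_clm_apply_of_dense (fun t _ => ?_)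
      (hT.dense_iSup_range_adjoint hJ) hcont).comp (f := fun t => (t, y))
      (by fun_prop) fun t ht => ⟨ht, trivial⟩
    simpa only [LinearIsometryEquiv.norm_map] using hT.exists_eventually_norm_le t

end Adjoint

section Stability

variable {Z : Type*} [NormedAddCommGroup Z] [InnerProductSpace ℝ Z] {T T₁ : ℝ → Z →L[ℝ] Z}
  {M b t : ℝ}

theorem sq_add_integral_sq_le {x g : ℝ → ℝ} (hb : 0 < b) (hg : Continuous g)
    (hx : ∀ s, HasDerivAt x (-b * x s + g s) s) (ht : 0 ≤ t) :
    x t ^ 2 + b * ∫ s in (0 : ℝ)..t, x s ^ 2 ≤ x 0 ^ 2 + b⁻¹ * ∫ s in (0 : ℝ)..t, g s ^ 2 := by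
  have hxc : Continuous x := continuous_iff_continuousAt.2 fun s => (hx s).continuousAt
  have hint {f : ℝ → ℝ} (hf : Continuous f) := hf.intervalIntegrable (μ := volume) 0 t
  have hderiv (s : ℝ) : HasDerivAt (fun s => x s ^ 2) (2 * x s * (-b * x s + g s)) s := by
    simpa using (hx s).fun_pow 2
  have hYoung (s : ℝ) : 2 * x s * (-b * x s + g s) ≤ b⁻¹ * g s ^ 2 - b * x s ^ 2 := by
    have hsq : 0 ≤ b⁻¹ * (g s - b * x s) ^ 2 := by positivity
    have hexpand : b⁻¹ * (g s - b * x s) ^ 2 = b⁻¹ * g s ^ 2 - 2 * x s * g s + b * x s ^ 2 := by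
      field_simp
      ring
    linarith
  have henergy : x t ^ 2 - x 0 ^ 2 ≤ ∫ s in (0 : ℝ)..t, (b⁻¹ * g s ^ 2 - b * x s ^ 2) := by
    rw [← intervalIntegral.integral_eq_sub_of_hasDerivAt (fun s _ => hderiv s)
      (hint (by fun_prop))]
    exact intervalIntegral.integral_mono_on ht (hint (by fun_prop)) (hint (by fun_prop))
      fun s _ => hYoung s
  rw [intervalIntegral.integral_sub (hint (by fun_prop)) (hint (by fun_prop)),
    intervalIntegral.integral_const_mul, intervalIntegral.integral_const_mul] at henergy
  linarith

theorem HasExpDecay.norm_sq_add_integral_norm_sq_le (hT : HasExpDecay T M b) {f v : ℝ → Z} {v₀ : Z}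
    (hv : IsMildSolution T (fun s _ => f s) v₀ v) (hf : Continuous f) (ht : 0 ≤ t) :
    ‖v t‖ ^ 2 + b * ∫ s in (0 : ℝ)..t, ‖v s‖ ^ 2 ≤
      M ^ 2 * (‖v₀‖ ^ 2 + b⁻¹ * ∫ s in (0 : ℝ)..t, ‖f s‖ ^ 2) := by
  set x : ℝ → ℝ := fun s => Real.exp (-b * s) * ‖v₀‖ + expConv b (fun r => ‖f r‖) s
  have hx (s : ℝ) : HasDerivAt x (-b * x s + ‖f s‖) s := by
    have hexp : HasDerivAt (fun s => Real.exp (-b * s) * ‖v₀‖)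
        (Real.exp (-b * s) * (-b * 1) * ‖v₀‖) s :=
      (((hasDerivAt_id s).const_mul (-b)).exp).mul_const ‖v₀‖
    exact (hexp.fun_add (hasDerivAt_expConv hf.norm b s)).congr_deriv (by ring)
  have hxc : Continuous x := continuous_iff_continuousAt.2 fun s => (hx s).continuousAt
  have hvx (s : ℝ) (hs : 0 ≤ s) : ‖v s‖ ^ 2 ≤ M ^ 2 * x s ^ 2 := by
    rw [← mul_pow]
    gcongr
    calc ‖v s‖ ≤ ‖T s v₀‖ + ‖mildIntegral T f s‖ := hv.2 s hs ▸ norm_add_le _ _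
      _ ≤ M * (Real.exp (-b * s) * ‖v₀‖) + M * expConv b (fun r => ‖f r‖) s :=
        add_le_add (hT.norm_apply_le hs v₀) (hT.norm_mildIntegral_le_expConv hf.continuousOn hs)
      _ = M * x s := (mul_add _ _ _).symm
  have := hT.rate_pos
  calc ‖v t‖ ^ 2 + b * ∫ s in (0 : ℝ)..t, ‖v s‖ ^ 2
      ≤ M ^ 2 * x t ^ 2 + b * ∫ s in (0 : ℝ)..t, M ^ 2 * x s ^ 2 := by
        gcongr
        · exact hvx t ht
        · exact intervalIntegral.integral_mono_on ht
            (ContinuousOn.intervalIntegrable_of_Icc ht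
              ((hv.1.mono Icc_subset_Ici_self).norm.pow 2))
            (Continuous.intervalIntegrable (by fun_prop) _ _) fun s hs => hvx s hs.1
    _ = M ^ 2 * (x t ^ 2 + b * ∫ s in (0 : ℝ)..t, x s ^ 2) := by
        rw [intervalIntegral.integral_const_mul]
        ring
    _ ≤ M ^ 2 * (x 0 ^ 2 + b⁻¹ * ∫ s in (0 : ℝ)..t, ‖f s‖ ^ 2) :=
        mul_le_mul_of_nonneg_left (sq_add_integral_sq_le hT.rate_pos hf.norm hx ht) (sq_nonneg M)
    _ = M ^ 2 * (‖v₀‖ ^ 2 + b⁻¹ * ∫ s in (0 : ℝ)..t, ‖f s‖ ^ 2) := by simp [x, expConv]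

variable [CompleteSpace Z]

theorem IsC0Semigroup.isExpStable_of_integral_norm_sq_le (hT : IsC0Semigroup T) {c : ℝ}
    (hM : ∀ t, 0 ≤ t → ‖T t‖ ≤ M)
    (hc : ∀ z t, 0 ≤ t → ∫ s in (0 : ℝ)..t, ‖T s z‖ ^ 2 ≤ c * ‖z‖ ^ 2) : IsExpStable T := by
  have hcont (z : Z) (t : ℝ) : ContinuousOn (fun s => ‖T s z‖ ^ 2) (Icc 0 t) :=
    ((hT.continuousOn z).mono Icc_subset_Ici_self).norm.pow 2
  have hdecay (z : Z) (t : ℝ) (ht : 0 ≤ t) : t * ‖T t z‖ ^ 2 ≤ M ^ 2 * c * ‖z‖ ^ 2 := by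
    calc t * ‖T t z‖ ^ 2 = ∫ s in (0 : ℝ)..t, ‖T t z‖ ^ 2 := by simp
      _ ≤ ∫ s in (0 : ℝ)..t, M ^ 2 * ‖T s z‖ ^ 2 := by
        refine intervalIntegral.integral_mono_on ht (by simp)
          (ContinuousOn.intervalIntegrable_of_Icc ht ((hcont z t).const_mul _)) fun s hs => ?_
        rw [← mul_pow, ← sub_add_cancel t s, hT.apply_add (sub_nonneg.2 hs.2) hs.1]
        gcongr
        exact (T (t - s)).le_of_opNorm_le (hM _ (sub_nonneg.2 hs.2)) _
      _ ≤ M ^ 2 * (c * ‖z‖ ^ 2) := by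
        rw [intervalIntegral.integral_const_mul]
        gcongr
        exact hc z t ht
      _ = M ^ 2 * c * ‖z‖ ^ 2 := by ring
  set t₀ := 4 * |M ^ 2 * c| + 1
  have ht₀ : 0 < t₀ := by positivity
  have hhalf : ‖T t₀‖ ≤ 1 / 2 := by
    refine ContinuousLinearMap.opNorm_le_bound _ (by positivity) fun z => ?_
    refine (sq_le_sq₀ (norm_nonneg _) (by positivity)).1 ?_
    refine le_of_mul_le_mul_left ((hdecay z t₀ ht₀.le).trans ?_) ht₀
    nlinarith [le_abs_self (M ^ 2 * c), sq_nonneg ‖z‖]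
  exact hT.isExpStable_of_norm_lt_one ht₀ (hhalf.trans_lt (by norm_num))

theorem IsExpStable.of_integral_norm_sq_le (hT₁ : IsExpStable T₁) (hT : IsC0Semigroup T)
    {G : Z →L[ℝ] Z} (hTT₁ : ∀ z, IsMildSolution T₁ (fun _ => G) z (fun t => T t z)) {κ : ℝ}
    (hκ : ∀ z t, 0 ≤ t → ∫ s in (0 : ℝ)..t, ‖G (T s z)‖ ^ 2 ≤ κ * ‖z‖ ^ 2) : IsExpStable T := by
  obtain ⟨M, b, hTb⟩ := hT₁.exists_hasExpDecay
  have hb := hTb.rate_pos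
  set K := M ^ 2 * (1 + b⁻¹ * |κ|)
  have henergy (z : Z) (t : ℝ) (ht : 0 ≤ t) :
      ‖T t z‖ ^ 2 + b * ∫ s in (0 : ℝ)..t, ‖T s z‖ ^ 2 ≤ K * ‖z‖ ^ 2 := by
    have hf : Continuous fun s => G (T (max s 0) z) := G.continuous.comp
      ((hT.continuousOn z).comp_continuous (by fun_prop) fun s => le_max_right s 0)
    have heq {s : ℝ} (hs : 0 ≤ s) : G (T (max s 0) z) = G (T s z) := by rw [max_eq_left hs]
    have hmild : IsMildSolution T₁ (fun s _ => G (T (max s 0) z)) z (fun t => T t z) :=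
      (hTT₁ z).congr_forcing fun s hs => (heq hs).symm
    calc ‖T t z‖ ^ 2 + b * ∫ s in (0 : ℝ)..t, ‖T s z‖ ^ 2
        ≤ M ^ 2 * (‖z‖ ^ 2 + b⁻¹ * ∫ s in (0 : ℝ)..t, ‖G (T (max s 0) z)‖ ^ 2) :=
          hTb.norm_sq_add_integral_norm_sq_le hmild hf ht
      _ = M ^ 2 * (‖z‖ ^ 2 + b⁻¹ * ∫ s in (0 : ℝ)..t, ‖G (T s z)‖ ^ 2) := by
          rw [intervalIntegral.integral_congr fun s hs => by
            rw [heq (uIcc_of_le ht ▸ hs).1]]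
      _ ≤ M ^ 2 * (‖z‖ ^ 2 + b⁻¹ * (|κ| * ‖z‖ ^ 2)) := by
          gcongr
          exact (hκ z t ht).trans (by gcongr; exact le_abs_self κ)
      _ = K * ‖z‖ ^ 2 := by ring
  have hnonneg (z : Z) (t : ℝ) (ht : 0 ≤ t) : 0 ≤ ∫ s in (0 : ℝ)..t, ‖T s z‖ ^ 2 :=
    intervalIntegral.integral_nonneg ht fun s _ => sq_nonneg _
  refine hT.isExpStable_of_integral_norm_sq_le (M := √K) (c := K / b) (fun t ht => ?_)
    fun z t ht => ?_
  · refine ContinuousLinearMap.opNorm_le_bound _ (by positivity) fun z => ?_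
    rw [← Real.sqrt_sq (norm_nonneg z), ← Real.sqrt_mul' _ (sq_nonneg _)]
    refine Real.le_sqrt_of_sq_le ?_
    linarith [henergy z t ht, mul_nonneg hb.le (hnonneg z t ht)]
  · rw [div_mul_eq_mul_div, le_div_iff₀' hb]
    linarith [henergy z t ht, sq_nonneg ‖T t z‖]

end Stability

section Riccati

variable {Z Y : Type*} [NormedAddCommGroup Z] [InnerProductSpace ℝ Z]

theorem norm_apply_sq_le_of_isPositive {Q : Z →L[ℝ] Z} (hQ : Q.IsPositive) (x : Z) :
    ‖Q x‖ ^ 2 ≤ ‖Q‖ * ⟪Q x, x⟫_ℝ := by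
  rcases (norm_nonneg Q).eq_or_lt with hzero | hpos
  · simp [norm_eq_zero.1 hzero.symm]
  have hw := hQ.inner_nonneg_left (‖Q‖ • x - Q x)
  have hexpand : ⟪Q (‖Q‖ • x - Q x), ‖Q‖ • x - Q x⟫_ℝ =
      ‖Q‖ ^ 2 * ⟪Q x, x⟫_ℝ - 2 * ‖Q‖ * ‖Q x‖ ^ 2 + ⟪Q (Q x), Q x⟫_ℝ := by
    simp only [map_sub, map_smul, inner_sub_left, inner_sub_right, real_inner_smul_left,
      real_inner_smul_right, hQ.inner_left_eq_inner_right (Q x) x, real_inner_self_eq_norm_sq]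
    ring
  have hQQ : ⟪Q (Q x), Q x⟫_ℝ ≤ ‖Q‖ * ‖Q x‖ ^ 2 := by
    calc ⟪Q (Q x), Q x⟫_ℝ ≤ ‖Q (Q x)‖ * ‖Q x‖ := real_inner_le_norm _ _
      _ ≤ ‖Q‖ * ‖Q x‖ * ‖Q x‖ := by gcongr; exact Q.le_opNorm _
      _ = ‖Q‖ * ‖Q x‖ ^ 2 := by ring
  refine le_of_mul_le_mul_left ?_ hpos
  linarith

variable [CompleteSpace Z] {A : Z →ₗ.[ℝ] Z} {T : ℝ → Z →L[ℝ] Z} {P : Z →L[ℝ] Z}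

theorem Generates.integral_eq_inner_sub_inner (hA : Generates A T) {e : Z → ℝ} (he : Continuous e)
    (hLyapunov : ∀ x y, (x, y) ∈ A.graph → ⟪x, P y⟫_ℝ + ⟪y, P x⟫_ℝ = -e x) (z : Z) {t : ℝ}
    (ht : 0 ≤ t) : ∫ s in (0 : ℝ)..t, e (T s z) = ⟪z, P z⟫_ℝ - ⟪T t z, P (T t z)⟫_ℝ := by
  have hT := hA.1
  have horbit (z : Z) : ContinuousOn (fun s => T s z) (Icc 0 t) :=
    (hT.continuousOn z).mono Icc_subset_Ici_self
  have hcont : Continuous fun z => ∫ s in (0 : ℝ)..t, e (T s z) := by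
    rw [← continuousOn_univ]
    refine continuousOn_intervalIntegral_of_continuousOn (f := fun z s => e (T s z)) ht ?_
    exact he.comp_continuousOn (hT.continuousOn_apply continuousOn_snd continuousOn_fst
      fun p hp => hp.2.1)
  have hdomain (x : Z) (hx : x ∈ A.domain) :
      ∫ s in (0 : ℝ)..t, e (T s x) = ⟪x, P x⟫_ℝ - ⟪T t x, P (T t x)⟫_ℝ := by
    have hgraph : (x, A ⟨x, hx⟩) ∈ A.graph := A.mem_graph ⟨x, hx⟩
    have hderiv (s : ℝ) (hs : s ∈ Ioo 0 t) :
        HasDerivWithinAt (fun s => ⟪T s x, P (T s x)⟫_ℝ) (-e (T s x)) (Ioi s) s := by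
      have hTs := hA.hasDerivWithinAt_apply hgraph hs.1.le
      exact (hTs.inner ℝ (P.hasFDerivAt.comp_hasDerivWithinAt s hTs)).congr_deriv
        (hLyapunov _ _ (hA.apply_mem_graph hgraph hs.1.le))
    have hFTC := intervalIntegral.integral_eq_sub_of_hasDeriv_right_of_le ht
      ((horbit x).inner (P.continuous.comp_continuousOn (horbit x))) hderiv
      ((he.comp_continuousOn (horbit x)).fun_neg.intervalIntegrable_of_Icc ht)
    simp only [intervalIntegral.integral_neg, hT.apply_zero] at hFTC
    linarith
  exact EqOn.closure hdomain hcont (by fun_prop) (hA.dense_domain z)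

variable {n : ℕ} {B : EuclideanSpace ℝ (Fin n) →L[ℝ] Z} [NormedAddCommGroup Y]
  [InnerProductSpace ℝ Y] {C : Z →L[ℝ] Y} {R : Matrix (Fin n) (Fin n) ℝ}

/-- The running cost `‖C x‖² + ⟨R K x, K x⟩` of the regulator in closed loop, `K = R⁻¹ B* P`. It is
encoded without `R`, as `R K = B* P` for invertible `R`. -/
noncomputable def closedLoopCost (B : EuclideanSpace ℝ (Fin n) →L[ℝ] Z) (C : Z →L[ℝ] Y)
    (R : Matrix (Fin n) (Fin n) ℝ) (P : Z →L[ℝ] Z) (x : Z) : ℝ :=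
  ‖C x‖ ^ 2 + ⟪lqrGain B R P x, (B†) (P x)⟫_ℝ

theorem isPositive_weightInv (hR : R.PosSemidef) : (weightInv R).IsPositive := by
  rw [← ContinuousLinearMap.isPositive_toLinearMap_iff]
  exact Matrix.isPositive_toEuclideanLin_iff.2 hR.inv

theorem continuous_closedLoopCost : Continuous (closedLoopCost B C R P) := by
  unfold closedLoopCost
  fun_prop

theorem norm_sq_lqrGain_le (hR : R.PosSemidef) (x : Z) :
    ‖lqrGain B R P x‖ ^ 2 ≤ ‖weightInv R‖ * ⟪lqrGain B R P x, (B†) (P x)⟫_ℝ :=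
  norm_apply_sq_le_of_isPositive (isPositive_weightInv hR) _

namespace IsRiccatiSolution

theorem isPositive (hP : IsRiccatiSolution A B C R P) : P.IsPositive :=
  (P.isPositive_iff').2 ⟨hP.selfAdjoint, fun x => real_inner_comm x (P x) ▸ hP.nonneg x⟩

theorem inner_closedLoop (hP : IsRiccatiSolution A B C R P) {x y : Z}
    (hxy : (x, y) ∈ (closedLoop A B R P).graph) :
    ⟪x, P y⟫_ℝ + ⟪y, P x⟫_ℝ = -closedLoopCost B C R P x := by
  rw [closedLoop, mem_graph_boundedPerturbation_iff, LinearPMap.mem_graph_iff] at hxy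
  obtain ⟨x, rfl, hy⟩ := hxy
  have hy' : y = A x - B (lqrGain B R P x) := by
    rw [hy]
    simp
  have hAre := hP.riccati x x
  have hsymm := hP.isPositive.inner_left_eq_inner_right (B (lqrGain B R P x)) (x : Z)
  have hadj : ⟪lqrGain B R P x, (B†) (P x)⟫_ℝ = ⟪B (lqrGain B R P x), P x⟫_ℝ :=
    B.adjoint_inner_right _ _
  rw [real_inner_self_eq_norm_sq] at hAre
  rw [hy', closedLoopCost, hadj, map_sub, inner_sub_right, inner_sub_left,
    real_inner_comm (P (B _)) (x : Z)]
  linarith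

theorem integral_closedLoopCost_le (hP : IsRiccatiSolution A B C R P)
    (hT : Generates (closedLoop A B R P) T) (z : Z) {t : ℝ} (ht : 0 ≤ t) :
    ∫ s in (0 : ℝ)..t, closedLoopCost B C R P (T s z) ≤ ‖P‖ * ‖z‖ ^ 2 := by
  calc ∫ s in (0 : ℝ)..t, closedLoopCost B C R P (T s z)
      = ⟪z, P z⟫_ℝ - ⟪T t z, P (T t z)⟫_ℝ :=
        hT.integral_eq_inner_sub_inner continuous_closedLoopCost
          (fun _ _ hxy => hP.inner_closedLoop hxy) z ht
    _ ≤ ⟪z, P z⟫_ℝ := sub_le_self _ (hP.nonneg _)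
    _ ≤ ‖z‖ * ‖P z‖ := real_inner_le_norm _ _
    _ ≤ ‖z‖ * (‖P‖ * ‖z‖) := by gcongr; exact P.le_opNorm z
    _ = ‖P‖ * ‖z‖ ^ 2 := by ring

end IsRiccatiSolution

theorem exists_norm_sq_le_closedLoopCost (hR : R.PosSemidef) (L : Y →L[ℝ] Z) :
    ∃ κ : ℝ, 0 ≤ κ ∧ ∀ x,
      ‖(-(B.comp (lqrGain B R P)) - L.comp C) x‖ ^ 2 ≤ κ * closedLoopCost B C R P x := by
  refine ⟨2 * (‖B‖ ^ 2 * ‖weightInv R‖ + ‖L‖ ^ 2), by positivity, fun x => ?_⟩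
  set a := ⟪lqrGain B R P x, (B†) (P x)⟫_ℝ
  have ha : 0 ≤ a := (isPositive_weightInv hR).inner_nonneg_left _
  have hBK : ‖B (lqrGain B R P x)‖ ^ 2 ≤ ‖B‖ ^ 2 * (‖weightInv R‖ * a) := by
    calc ‖B (lqrGain B R P x)‖ ^ 2 ≤ (‖B‖ * ‖lqrGain B R P x‖) ^ 2 := by
          gcongr; exact B.le_opNorm _
      _ = ‖B‖ ^ 2 * ‖lqrGain B R P x‖ ^ 2 := mul_pow _ _ _
      _ ≤ ‖B‖ ^ 2 * (‖weightInv R‖ * a) := by gcongr; exact norm_sq_lqrGain_le hR x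
  have hLC : ‖L (C x)‖ ^ 2 ≤ ‖L‖ ^ 2 * ‖C x‖ ^ 2 := by
    rw [← mul_pow]
    gcongr
    exact L.le_opNorm _
  calc ‖(-(B.comp (lqrGain B R P)) - L.comp C) x‖ ^ 2
      ≤ (‖B (lqrGain B R P x)‖ + ‖L (C x)‖) ^ 2 := by
        gcongr
        exact (norm_sub_le _ _).trans_eq (by simp)
    _ ≤ 2 * (‖B (lqrGain B R P x)‖ ^ 2 + ‖L (C x)‖ ^ 2) := add_sq_le
    _ ≤ 2 * (‖B‖ ^ 2 * (‖weightInv R‖ * a) + ‖L‖ ^ 2 * ‖C x‖ ^ 2) := by gcongr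
    _ ≤ 2 * (‖B‖ ^ 2 * ‖weightInv R‖ + ‖L‖ ^ 2) * (‖C x‖ ^ 2 + a) := by
        have : 0 ≤ ‖B‖ ^ 2 * ‖weightInv R‖ * ‖C x‖ ^ 2 := by positivity
        have : 0 ≤ ‖L‖ ^ 2 * a := by positivity
        linarith

theorem IsRiccatiSolution.isExpStable (hP : IsRiccatiSolution A B C R P) (hR : R.PosSemidef)
    (hdet : IsExpDetectable A C) (hT : Generates (closedLoop A B R P) T) : IsExpStable T := by
  obtain ⟨L, T₁, hT₁, hstable⟩ := hdet
  obtain ⟨κ, hκ0, hκ⟩ := exists_norm_sq_le_closedLoopCost (B := B) (C := C) (P := P) hR L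
  set G := -(B.comp (lqrGain B R P)) - L.comp C with hG
  have hA : closedLoop A B R P = boundedPerturbation (boundedPerturbation A (L.comp C)) G := by
    rw [boundedPerturbation_boundedPerturbation, hG, add_sub_cancel, closedLoop]
  refine hstable.of_integral_norm_sq_le hT.1
    (hT₁.isMildSolution_boundedPerturbation (hA ▸ hT)) (κ := κ * ‖P‖) fun z t ht => ?_
  have horbit : ContinuousOn (fun s => T s z) (Icc 0 t) :=
    (hT.1.continuousOn z).mono Icc_subset_Ici_self
  calc ∫ s in (0 : ℝ)..t, ‖G (T s z)‖ ^ 2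
      ≤ ∫ s in (0 : ℝ)..t, κ * closedLoopCost B C R P (T s z) :=
        intervalIntegral.integral_mono_on ht
          (ContinuousOn.intervalIntegrable_of_Icc ht (by fun_prop))
          (ContinuousOn.intervalIntegrable_of_Icc ht
            ((continuous_closedLoopCost.comp_continuousOn horbit).const_mul κ)) fun s _ => hκ _
    _ = κ * ∫ s in (0 : ℝ)..t, closedLoopCost B C R P (T s z) :=
        intervalIntegral.integral_const_mul _ _
    _ ≤ κ * (‖P‖ * ‖z‖ ^ 2) := by gcongr; exact hP.integral_closedLoopCost_le hT z ht
    _ = κ * ‖P‖ * ‖z‖ ^ 2 := (mul_assoc _ _ _).symm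

end Riccati

section Gramian

variable {Z Y : Type*} [NormedAddCommGroup Z] [InnerProductSpace ℝ Z] [CompleteSpace Z]
  [NormedAddCommGroup Y] [InnerProductSpace ℝ Y] [CompleteSpace Y]
  {C : Z →L[ℝ] Y} {T : ℝ → Z →L[ℝ] Z} {M b : ℝ}

theorem IsC0Semigroup.continuousOn_gramianIntegrand (hT : IsC0Semigroup T) (z : Z) :
    ContinuousOn (gramianIntegrand T C z) (Ici 0) :=
  (isC0Semigroup_adjoint hT).continuousOn_apply continuousOn_id
    ((C†).continuous.comp_continuousOn (C.continuous.comp_continuousOn (hT.continuousOn z)))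
    fun _ ht => ht

theorem HasExpDecay.norm_gramianIntegrand_le (hT : HasExpDecay T M b) (z : Z) {t : ℝ}
    (ht : 0 ≤ t) :
    ‖gramianIntegrand T C z t‖ ≤ (M * ‖C‖) ^ 2 * ‖z‖ * Real.exp (-(2 * b) * t) := by
  have hadj : ‖(T t)†‖ ≤ M * Real.exp (-b * t) :=
    (LinearIsometryEquiv.norm_map _ _).trans_le (hT.norm_le t ht)
  have hexp : Real.exp (-(2 * b) * t) = Real.exp (-b * t) * Real.exp (-b * t) := by
    rw [← Real.exp_add]
    ring_nf
  have hCadj : ‖(C†) (C (T t z))‖ ≤ ‖C‖ * (‖C‖ * ‖T t z‖) :=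
    (C†).le_of_opNorm_le_of_le (LinearIsometryEquiv.norm_map _ _).le (C.le_opNorm _)
  calc ‖gramianIntegrand T C z t‖ ≤ M * Real.exp (-b * t) * (‖C‖ * (‖C‖ * ‖T t z‖)) :=
        ((T t)†).le_of_opNorm_le_of_le hadj hCadj
    _ ≤ M * Real.exp (-b * t) * (‖C‖ * (‖C‖ * (M * (Real.exp (-b * t) * ‖z‖)))) := by
        have := hT.const_pos
        gcongr
        exact hT.norm_apply_le ht z
    _ = (M * ‖C‖) ^ 2 * ‖z‖ * Real.exp (-(2 * b) * t) := by
        rw [hexp]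
        ring

theorem HasExpDecay.integrableOn_gramianIntegrand (hTb : HasExpDecay T M b)
    (hT : IsC0Semigroup T) (z : Z) : IntegrableOn (gramianIntegrand T C z) (Ioi 0) :=
  Integrable.mono' ((exp_neg_integrableOn_Ioi 0 (mul_pos two_pos hTb.rate_pos)).const_mul _)
    (((hT.continuousOn_gramianIntegrand z).mono Ioi_subset_Ici_self).aestronglyMeasurable
      measurableSet_Ioi)
    (ae_restrict_of_forall_mem measurableSet_Ioi fun _ ht =>
      hTb.norm_gramianIntegrand_le z (le_of_lt ht))

theorem HasExpDecay.norm_obsGramian_le (hTb : HasExpDecay T M b) (z : Z) :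
    ‖obsGramian T C z‖ ≤ (M * ‖C‖) ^ 2 / (2 * b) * ‖z‖ := by
  have hb : 0 < 2 * b := mul_pos two_pos hTb.rate_pos
  calc ‖obsGramian T C z‖
      ≤ ∫ t in Ioi (0 : ℝ), (M * ‖C‖) ^ 2 * ‖z‖ * Real.exp (-(2 * b) * t) :=
        norm_integral_le_of_norm_le ((exp_neg_integrableOn_Ioi 0 hb).const_mul _)
          (ae_restrict_of_forall_mem measurableSet_Ioi fun _ ht =>
            hTb.norm_gramianIntegrand_le z (le_of_lt ht))
    _ = (M * ‖C‖) ^ 2 / (2 * b) * ‖z‖ := by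
        rw [integral_const_mul, integral_exp_mul_Ioi (neg_lt_zero.2 hb), mul_zero, Real.exp_zero,
          neg_div_neg_eq]
        ring

theorem HasExpDecay.exists_obsGramian_clm (hTb : HasExpDecay T M b) (hT : IsC0Semigroup T) :
    ∃ W : Z →L[ℝ] Z, ⇑W = obsGramian T C := by
  have hint (z : Z) := hTb.integrableOn_gramianIntegrand (C := C) hT z
  have hlin : IsLinearMap ℝ (obsGramian T C) :=
    { map_add := fun x y => by
        simp only [obsGramian, ← integral_add (hint x) (hint y)]
        simp only [gramianIntegrand, map_add]
      map_smul := fun c x => by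
        simp only [obsGramian, ← integral_smul, gramianIntegrand, map_smul] }
  exact ⟨hlin.mk'.mkContinuous _ hTb.norm_obsGramian_le, rfl⟩

theorem HasExpDecay.tendsto_horizonFeedforward (hTb : HasExpDecay T M b) (hT : IsC0Semigroup T)
    {v : ℝ → Z} {v₀ : Z} (hv : IsMildSolution T (fun _ _ => 0) v₀ v) {t : ℝ} (ht : 0 ≤ t) :
    Tendsto (fun t₁ : ℝ => horizonFeedforward T C (fun s => -C (v s)) t₁ t) atTop
      (𝓝 (obsGramian T C (v t))) := by
  have hlim : Tendsto (fun t₁ => ∫ τ in (0 : ℝ)..(t₁ - t), gramianIntegrand T C (v t) τ) atTop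
      (𝓝 (obsGramian T C (v t))) :=
    intervalIntegral_tendsto_integral_Ioi 0 (hTb.integrableOn_gramianIntegrand hT (v t))
      (tendsto_atTop_add_const_right _ _ tendsto_id)
  have hshift {s : ℝ} (hs : t ≤ s) : v s = T (s - t) (v t) := by
    rw [hv.eq_apply ht, hv.eq_apply (ht.trans hs), ← hT.apply_add (sub_nonneg.2 hs) ht,
      sub_add_cancel]
  refine hlim.congr' ?_
  filter_upwards [eventually_ge_atTop t] with t₁ ht₁
  calc ∫ τ in (0 : ℝ)..(t₁ - t), gramianIntegrand T C (v t) τ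
      = ∫ s in t..t₁, gramianIntegrand T C (v t) (s - t) := by
        rw [intervalIntegral.integral_comp_sub_right, sub_self]
    _ = ∫ s in t..t₁, -((T (s - t))†) ((C†) (-C (v s))) := by
        refine intervalIntegral.integral_congr fun s hs => ?_
        simp only [gramianIntegrand, map_neg, neg_neg, hshift (uIcc_of_le ht₁ ▸ hs).1]
    _ = horizonFeedforward T C (fun s => -C (v s)) t₁ t := by
        rw [horizonFeedforward, intervalIntegral.integral_symm t t₁, intervalIntegral.integral_neg]

end Gramian

section ControlError

variable {Z : Type*} [NormedAddCommGroup Z] [InnerProductSpace ℝ Z] [CompleteSpace Z]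
  {S T : ℝ → Z →L[ℝ] Z} {M b : ℝ}

theorem HasExpDecay.norm_sub_le_of_isMildSolution (hTb : HasExpDecay T M b)
    (hS : IsC0Semigroup S) (hT : IsC0Semigroup T) {G : Z →L[ℝ] Z}
    (hST : ∀ z, IsMildSolution S (fun _ => G) z (fun t => T t z)) {g v w : ℝ → Z} {v₀ w₀ : Z}
    {k : ℝ} (hg : ContinuousOn g (Ici 0)) (hk : ∀ s, 0 ≤ s → ‖g s‖ ≤ k)
    (hv : IsMildSolution S (fun s z => G z + g s) v₀ v)
    (hw : IsMildSolution S (fun _ z => G z) w₀ w) {t : ℝ} (ht : 0 ≤ t) :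
    ‖v t - w t‖ ≤ M * ‖v₀ - w₀‖ + M / b * k := by
  have hv' : v t = T t v₀ + mildIntegral T g t := (hv.variation_of_constants hS hT hST hg).2 t ht
  have hw' : w t = T t w₀ :=
    (IsMildSolution.variation_of_constants hS hT hST (g := fun _ => 0) continuousOn_const
      (hw.congr_forcing fun _ _ => (add_zero _).symm)).eq_apply ht
  calc ‖v t - w t‖ = ‖T t (v₀ - w₀) + mildIntegral T g t‖ := by
        rw [hv', hw', map_sub, add_sub_right_comm]
    _ ≤ M * ‖v₀ - w₀‖ + M / b * k := (norm_add_le _ _).trans (add_le_add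
        (hTb.norm_apply_le_const ht _)
        (hTb.norm_mildIntegral_le (hg.mono Icc_subset_Ici_self) ht fun s hs => hk s hs.1))

variable {U : Type*} [NormedAddCommGroup U] [NormedSpace ℝ U]

theorem HasExpDecay.exists_norm_feedback_sub_le (hTb : HasExpDecay T M b) (hS : IsC0Semigroup S)
    (hT : IsC0Semigroup T) (B : U →L[ℝ] Z) (K F : Z →L[ℝ] U)
    (hST : ∀ z, IsMildSolution S (fun _ => ⇑(-B.comp K)) z (fun t => T t z)) :
    ∃ c : ℝ, 0 ≤ c ∧ ∀ (vp₀ v₀ vs₀ : Z) (vp v vs : ℝ → Z),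
      IsMildSolution T (fun _ _ => 0) vp₀ vp →
      IsMildSolution S (fun τ z => B (-K z + F (vp τ))) v₀ v →
      IsMildSolution S (fun _ z => B (-K z)) vs₀ vs → ∀ t, 0 ≤ t →
        ‖-K (v t) + F (vp t) - -K (vs t)‖ ≤ c * (‖vp₀‖ + ‖v₀ - vs₀‖) := by
  have hM := hTb.const_pos
  have hb := hTb.rate_pos
  refine ⟨‖F‖ * M + ‖K‖ * (M + M / b * (‖B‖ * (‖F‖ * M))), by positivity,
    fun vp₀ v₀ vs₀ vp v vs hvp hv hvs t ht => ?_⟩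
  have hF (s : ℝ) (hs : 0 ≤ s) : ‖F (vp s)‖ ≤ ‖F‖ * (M * ‖vp₀‖) :=
    F.le_opNorm_of_le (hvp.eq_apply hs ▸ hTb.norm_apply_le_const hs vp₀)
  have hdev : ‖v t - vs t‖ ≤ M * ‖v₀ - vs₀‖ + M / b * (‖B‖ * (‖F‖ * (M * ‖vp₀‖))) :=
    hTb.norm_sub_le_of_isMildSolution hS hT hST
      (B.continuous.comp_continuousOn (F.continuous.comp_continuousOn hvp.1))
      (fun s hs => B.le_opNorm_of_le (hF s hs)) (hv.congr_forcing fun s _ => by simp)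
      (hvs.congr_forcing fun s _ => by simp) ht
  calc ‖-K (v t) + F (vp t) - -K (vs t)‖ = ‖F (vp t) - K (v t - vs t)‖ := by
        rw [map_sub]
        congr 1
        abel
    _ ≤ ‖F (vp t)‖ + ‖K (v t - vs t)‖ := norm_sub_le _ _
    _ ≤ ‖F‖ * (M * ‖vp₀‖) +
          ‖K‖ * (M * ‖v₀ - vs₀‖ + M / b * (‖B‖ * (‖F‖ * (M * ‖vp₀‖)))) :=
        add_le_add (hF t ht) (K.le_opNorm_of_le hdev)
    _ ≤ ‖F‖ * (M * (‖vp₀‖ + ‖v₀ - vs₀‖)) + ‖K‖ * (M * (‖vp₀‖ + ‖v₀ - vs₀‖) +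
          M / b * (‖B‖ * (‖F‖ * (M * (‖vp₀‖ + ‖v₀ - vs₀‖))))) := by
        gcongr <;> simp
    _ = (‖F‖ * M + ‖K‖ * (M + M / b * (‖B‖ * (‖F‖ * M)))) * (‖vp₀‖ + ‖v₀ - vs₀‖) := by ring

end ControlError

section RegulatorLaw

variable {Z Y : Type*} [NormedAddCommGroup Z] [InnerProductSpace ℝ Z] [CompleteSpace Z]
  [NormedAddCommGroup Y] [InnerProductSpace ℝ Y] [CompleteSpace Y] {n : ℕ}
  {B : EuclideanSpace ℝ (Fin n) →L[ℝ] Z} {C : Z →L[ℝ] Y} {R : Matrix (Fin n) (Fin n) ℝ}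
  {P W : Z →L[ℝ] Z} {S T : ℝ → Z →L[ℝ] Z} {M b : ℝ}

theorem regLaw_eq (hW : ⇑W = obsGramian T C) (x z : Z) :
    regLaw T B C R P x z = -lqrGain B R P z + (-(weightedAdjoint B R).comp W) x := by
  simp [regLaw, hW, sub_eq_add_neg]

theorem regLaw_sub_self (hW : ⇑W = obsGramian T C) (x z : Z) :
    regLaw T B C R P x (z - x) =
      -lqrGain B R P z + (lqrGain B R P - (weightedAdjoint B R).comp W) x := by
  rw [regLaw_eq hW, map_sub, neg_apply, sub_apply]
  abel

theorem HasExpDecay.exists_norm_regLaw_sub_lqrLaw_le_exp (hTb : HasExpDecay T M b)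
    (hT : IsC0Semigroup T) :
    ∃ c : ℝ, 0 ≤ c ∧ ∀ (vp₀ : Z) (vp : ℝ → Z), IsMildSolution T (fun _ _ => 0) vp₀ vp →
      ∀ t, 0 ≤ t → ∀ z, ‖regLaw T B C R P (vp t) (z - vp t) - lqrLaw B R P z‖ ≤
        c * Real.exp (-b * t) * ‖vp₀‖ := by
  obtain ⟨W, hW⟩ := hTb.exists_obsGramian_clm (C := C) hT
  set F := lqrGain B R P - (weightedAdjoint B R).comp W with hF
  refine ⟨‖F‖ * M, mul_nonneg (norm_nonneg F) hTb.const_pos.le, fun vp₀ vp hvp t ht z => ?_⟩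
  calc ‖regLaw T B C R P (vp t) (z - vp t) - lqrLaw B R P z‖ = ‖F (T t vp₀)‖ := by
        rw [regLaw_sub_self hW, ← hF, lqrLaw, add_sub_cancel_left, hvp.eq_apply ht]
    _ ≤ ‖F‖ * (M * (Real.exp (-b * t) * ‖vp₀‖)) := F.le_opNorm_of_le (hTb.norm_apply_le ht vp₀)
    _ = ‖F‖ * M * Real.exp (-b * t) * ‖vp₀‖ := by ring

theorem HasExpDecay.exists_norm_regLaw_sub_lqrLaw_le_homogeneous (hTb : HasExpDecay T M b)
    (hS : IsC0Semigroup S) (hT : IsC0Semigroup T)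
    (hST : ∀ z, IsMildSolution S (fun _ => ⇑(-B.comp (lqrGain B R P))) z (fun t => T t z)) :
    ∃ c : ℝ, 0 ≤ c ∧ ∀ (vp₀ vh₀ vs₀ : Z) (vp vh vs : ℝ → Z),
      IsMildSolution T (fun _ _ => 0) vp₀ vp →
      IsMildSolution S (fun τ z => B (regLaw T B C R P (vp τ) z)) vh₀ vh →
      IsMildSolution S (fun _ z => B (lqrLaw B R P z)) vs₀ vs → ∀ t, 0 ≤ t →
        ‖regLaw T B C R P (vp t) (vh t) - lqrLaw B R P (vs t)‖ ≤
          c * (‖vp₀‖ + ‖vp₀ + vh₀ - vs₀‖) := by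
  obtain ⟨W, hW⟩ := hTb.exists_obsGramian_clm (C := C) hT
  obtain ⟨c, hc, hle⟩ :=
    hTb.exists_norm_feedback_sub_le hS hT B _ (-(weightedAdjoint B R).comp W) hST
  refine ⟨c * 2, by positivity, fun vp₀ vh₀ vs₀ vp vh vs hvp hvh hvs t ht => ?_⟩
  simp only [regLaw_eq hW] at hvh ⊢
  have htri : ‖vh₀ - vs₀‖ ≤ ‖vp₀ + vh₀ - vs₀‖ + ‖vp₀‖ := by
    calc ‖vh₀ - vs₀‖ = ‖vp₀ + vh₀ - vs₀ - vp₀‖ := by rw [add_sub_assoc, add_sub_cancel_left]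
      _ ≤ ‖vp₀ + vh₀ - vs₀‖ + ‖vp₀‖ := norm_sub_le _ _
  calc ‖-lqrGain B R P (vh t) + (-(weightedAdjoint B R).comp W) (vp t) - lqrLaw B R P (vs t)‖
      ≤ c * (‖vp₀‖ + ‖vh₀ - vs₀‖) := hle _ _ _ _ _ _ hvp hvh hvs t ht
    _ ≤ c * (2 * (‖vp₀‖ + ‖vp₀ + vh₀ - vs₀‖)) := by
        gcongr
        linarith [norm_nonneg (vp₀ + vh₀ - vs₀)]
    _ = c * 2 * (‖vp₀‖ + ‖vp₀ + vh₀ - vs₀‖) := (mul_assoc _ _ _).symm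

theorem HasExpDecay.exists_norm_regLaw_sub_lqrLaw_le_plant (hTb : HasExpDecay T M b)
    (hS : IsC0Semigroup S) (hT : IsC0Semigroup T)
    (hST : ∀ z, IsMildSolution S (fun _ => ⇑(-B.comp (lqrGain B R P))) z (fun t => T t z)) :
    ∃ c : ℝ, 0 ≤ c ∧ ∀ (vp₀ v₀ vs₀ : Z) (vp v vs : ℝ → Z),
      IsMildSolution T (fun _ _ => 0) vp₀ vp →
      IsMildSolution S (fun τ z => B (regLaw T B C R P (vp τ) (z - vp τ))) v₀ v →
      IsMildSolution S (fun _ z => B (lqrLaw B R P z)) vs₀ vs → ∀ t, 0 ≤ t →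
        ‖regLaw T B C R P (vp t) (v t - vp t) - lqrLaw B R P (vs t)‖ ≤
          c * (‖vp₀‖ + ‖v₀ - vs₀‖) := by
  obtain ⟨W, hW⟩ := hTb.exists_obsGramian_clm (C := C) hT
  simp only [regLaw_sub_self hW]
  exact hTb.exists_norm_feedback_sub_le hS hT B _ _ hST

end RegulatorLaw

end DyadicControl

theorem lemma3_general {Z Y : Type*} [NormedAddCommGroup Z] [InnerProductSpace ℝ Z]
    [CompleteSpace Z] [NormedAddCommGroup Y] [InnerProductSpace ℝ Y] [CompleteSpace Y] {nu : ℕ}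
    (A : Z →ₗ.[ℝ] Z) (S : ℝ → Z →L[ℝ] Z) (hA : DyadicControl.Generates A S)
    (B : EuclideanSpace ℝ (Fin nu) →L[ℝ] Z) (C : Z →L[ℝ] Y)
    (R : Matrix (Fin nu) (Fin nu) ℝ) (hR : R.PosDef)
    (hdet : DyadicControl.IsExpDetectable A C)
    (P : Z →L[ℝ] Z) (hP : DyadicControl.IsRiccatiSolution A B C R P) :
    ∃ Tm : ℝ → Z →L[ℝ] Z,
      DyadicControl.Generates (DyadicControl.closedLoop A B R P) Tm ∧
      (∀ z : Z, IntegrableOn (DyadicControl.gramianIntegrand Tm C z) (Ioi 0)) ∧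
      (∀ (vp₀ : Z) (vp : ℝ → Z),
        DyadicControl.IsMildSolution Tm (fun _ _ => 0) vp₀ vp →
        ∀ t : ℝ, 0 ≤ t →
          Tendsto (fun T : ℝ =>
              DyadicControl.horizonFeedforward Tm C (fun s => -C (vp s)) T t)
            atTop (𝓝 (DyadicControl.obsGramian Tm C (vp t)))) ∧
      ∃ M β : ℝ, 0 < M ∧ 0 < β ∧
        (∀ (vp₀ : Z) (vp : ℝ → Z),
          DyadicControl.IsMildSolution Tm (fun _ _ => 0) vp₀ vp →
          ∀ t : ℝ, 0 ≤ t → ∀ z : Z,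
            ‖DyadicControl.regLaw Tm B C R P (vp t) (z - vp t)
                - DyadicControl.lqrLaw B R P z‖
              ≤ M * Real.exp (-β * t) * ‖vp₀‖) ∧
        (∀ (vp₀ vh₀ vs₀ : Z) (vp vh vs : ℝ → Z),
          DyadicControl.IsMildSolution Tm (fun _ _ => 0) vp₀ vp →
          DyadicControl.IsMildSolution S
            (fun τ z => B (DyadicControl.regLaw Tm B C R P (vp τ) z)) vh₀ vh →
          DyadicControl.IsMildSolution S
            (fun _ z => B (DyadicControl.lqrLaw B R P z)) vs₀ vs →
          ∀ t : ℝ, 0 ≤ t →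
            ‖DyadicControl.regLaw Tm B C R P (vp t) (vh t) - DyadicControl.lqrLaw B R P (vs t)‖
              ≤ M * (‖vp₀‖ + ‖vp₀ + vh₀ - vs₀‖)) ∧
        (∀ (vp₀ v₀ vs₀ : Z) (vp v vs : ℝ → Z),
          DyadicControl.IsMildSolution Tm (fun _ _ => 0) vp₀ vp →
          DyadicControl.IsMildSolution S
            (fun τ z => B (DyadicControl.regLaw Tm B C R P (vp τ) (z - vp τ))) v₀ v →
          DyadicControl.IsMildSolution S
            (fun _ z => B (DyadicControl.lqrLaw B R P z)) vs₀ vs →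
          ∀ t : ℝ, 0 ≤ t →
            ‖DyadicControl.regLaw Tm B C R P (vp t) (v t - vp t)
                - DyadicControl.lqrLaw B R P (vs t)‖
              ≤ M * (‖vp₀‖ + ‖v₀ - vs₀‖)) := by
  obtain ⟨T, hT⟩ := hA.exists_boundedPerturbation (-(B.comp (DyadicControl.lqrGain B R P)))
  have hST := hA.isMildSolution_boundedPerturbation hT
  obtain ⟨M, b, hTb⟩ := (hP.isExpStable hR.posSemidef hdet hT).exists_hasExpDecay
  obtain ⟨c₁, hc₁, hlaw⟩ := hTb.exists_norm_regLaw_sub_lqrLaw_le_exp (B := B) (C := C) (R := R)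
    (P := P) hT.1
  obtain ⟨c₂, hc₂, hhom⟩ := hTb.exists_norm_regLaw_sub_lqrLaw_le_homogeneous (C := C) hA.1 hT.1
    hST
  obtain ⟨c₃, hc₃, hplant⟩ := hTb.exists_norm_regLaw_sub_lqrLaw_le_plant (C := C) hA.1 hT.1 hST
  refine ⟨T, hT, fun z => hTb.integrableOn_gramianIntegrand hT.1 z,
    fun _ _ hvp _ ht => hTb.tendsto_horizonFeedforward hT.1 hvp ht,
    c₁ + c₂ + c₃ + 1, b, by positivity, hTb.rate_pos,
    fun vp₀ vp hvp t ht z => (hlaw vp₀ vp hvp t ht z).trans ?_,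
    fun vp₀ vh₀ vs₀ vp vh vs hvp hvh hvs t ht =>
      (hhom vp₀ vh₀ vs₀ vp vh vs hvp hvh hvs t ht).trans ?_,
    fun vp₀ v₀ vs₀ vp v vs hvp hv hvs t ht =>
      (hplant vp₀ v₀ vs₀ vp v vs hvp hv hvs t ht).trans ?_⟩
  all_goals gcongr; linarith

theorem lemma3 {Z : Type*} [NormedAddCommGroup Z] [InnerProductSpace ℝ Z] [CompleteSpace Z]
    {nu ny : ℕ}
    -- the plant: `A` generates the semigroup `S`; `B`, `C` are bounded; the weight is `R > 0`
    (A : Z →ₗ.[ℝ] Z) (S : ℝ → Z →L[ℝ] Z) (hA : DyadicControl.Generates A S)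
    (B : EuclideanSpace ℝ (Fin nu) →L[ℝ] Z) (C : Z →L[ℝ] EuclideanSpace ℝ (Fin ny))
    (R : Matrix (Fin nu) (Fin nu) ℝ) (hR : R.PosDef)
    (hstab : DyadicControl.IsExpStabilizable A B)
    (hdet : DyadicControl.IsExpDetectable A C)
    (P : Z →L[ℝ] Z) (hP : DyadicControl.IsRiccatiSolution A B C R P) :
    -- the closed-loop operator generates a semigroup, and the Gramian integral converges
    ∃ Tm : ℝ → Z →L[ℝ] Z,
      DyadicControl.Generates (DyadicControl.closedLoop A B R P) Tm ∧
      (∀ z : Z, IntegrableOn (DyadicControl.gramianIntegrand Tm C z) (Ioi 0)) ∧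
      -- the static feedforward is the limit for an infinite horizon, with `σ = r - y_p = -C v_p`
      (∀ (vp₀ : Z) (vp : ℝ → Z),
        DyadicControl.IsMildSolution Tm (fun _ _ => 0) vp₀ vp →
        ∀ t : ℝ, 0 ≤ t →
          Tendsto (fun T : ℝ =>
              DyadicControl.horizonFeedforward Tm C (fun s => -C (vp s)) T t)
            atTop (𝓝 (DyadicControl.obsGramian Tm C (vp t)))) ∧
      ∃ M β : ℝ, 0 < M ∧ 0 < β ∧
        -- exponential convergence of the control laws, uniformly in the state `z = v_p + v_h`
        (∀ (vp₀ : Z) (vp : ℝ → Z),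
          DyadicControl.IsMildSolution Tm (fun _ _ => 0) vp₀ vp →
          ∀ t : ℝ, 0 ≤ t → ∀ z : Z,
            ‖DyadicControl.regLaw Tm B C R P (vp t) (z - vp t)
                - DyadicControl.lqrLaw B R P z‖
              ≤ M * Real.exp (-β * t) * ‖vp₀‖) ∧
        -- boundedness of the error of the control signals, for the converged-observer system
        (∀ (vp₀ vh₀ vs₀ : Z) (vp vh vs : ℝ → Z),
          DyadicControl.IsMildSolution Tm (fun _ _ => 0) vp₀ vp →
          DyadicControl.IsMildSolution S
            (fun τ z => B (DyadicControl.regLaw Tm B C R P (vp τ) z)) vh₀ vh →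
          DyadicControl.IsMildSolution S
            (fun _ z => B (DyadicControl.lqrLaw B R P z)) vs₀ vs →
          ∀ t : ℝ, 0 ≤ t →
            ‖DyadicControl.regLaw Tm B C R P (vp t) (vh t) - DyadicControl.lqrLaw B R P (vs t)‖
              ≤ M * (‖vp₀‖ + ‖vp₀ + vh₀ - vs₀‖)) ∧
        -- the same when the law drives the plant `v' = A v + B u`, with `v_h = v - v_p`
        (∀ (vp₀ v₀ vs₀ : Z) (vp v vs : ℝ → Z),
          DyadicControl.IsMildSolution Tm (fun _ _ => 0) vp₀ vp →
          DyadicControl.IsMildSolution S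
            (fun τ z => B (DyadicControl.regLaw Tm B C R P (vp τ) (z - vp τ))) v₀ v →
          DyadicControl.IsMildSolution S
            (fun _ z => B (DyadicControl.lqrLaw B R P z)) vs₀ vs →
          ∀ t : ℝ, 0 ≤ t →
            ‖DyadicControl.regLaw Tm B C R P (vp t) (v t - vp t)
                - DyadicControl.lqrLaw B R P (vs t)‖
              ≤ M * (‖vp₀‖ + ‖v₀ - vs₀‖)) := by
  exact lemma3_general A S hA B C R hR hdet P hP
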